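/- Let $\mathfrak g$ be a finite-dimensional simple complex Lie algebra with Killing form $\kappa$, let $g=\dim\mathfrak g$, let $l$ be its rank, and put $d=\frac{g+l}{2}$. Assume $d\ge 3$, that is, $\mathfrak g\not\cong\mathfrak{sl}_2(\mathbb C)$. Let $w(x,y,z)=\kappa([x,y],z)$, regarded through $\kappa$ as an element of $\bigwedge^3\mathfrak g$, and let $\delta:\bigwedge^{k}\mathfrak g\to\bigwedge^{k+3}\mathfrak g$ be $\eta\mapsto\eta\wedge w$. Let $\mathbb G=\mathbb G(d,\mathfrak g)$ be the grassmannian of $d$-dimensional subspaces of $\mathfrak g$, with tautological bundle $K\subset\mathfrak g\otimes\mathcal O_{\mathbb G}$ and $\mathcal O_{\mathbb G}(1)=(\bigwedge^dK)^\vee$, and let $I_Y\subset\mathcal O_{\mathbb G}$ be the ideal sheaf that is the image of the morphism $\bigwedge^3K\to\mathcal O_{\mathbb G}$ given by restricting $w$ to $K$ (it defines the variety $Y$ of $d$-dimensional subspaces on which $w$ vanishes). Write $\langle\cdot,\cdot\rangle$ for the bilinear form on $\bigwedge^d\mathfrak g$ induced by $\kappa$, and map $\bigwedge^d\mathfrak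 g$ to $H^0(\mathcal O_{\mathbb G}(1))$ by sending $u$ to the section whose value at $\Lambda\in\mathbb G$ is the form $(v_1,\dots,v_d)\mapsto\langle u,v_1\wedge\dots\wedge v_d\rangle$ on $\Lambda$. (1) This map is injective, and under it $\delta(\bigwedge^{d-3}\mathfrak g)$ is contained in $H^0(I_Y(1))$. (2) Let $N=\{u\in\bigwedge^d\mathfrak g:\langle\delta(\eta),u\rangle=0\text{ for all }\eta\in\bigwedge^{d-3}\mathfrak g\}$. Then $\dim N<\dim\bigwedge^d\mathfrak g$. Moreover, let $\sigma$ be an involution of $\mathfrak g$ whose symmetric space has rank $l$ (the maximal dimension of the $(-1)$-eigenspace of $\sigma$ on a $\sigma$-invariant Cartan subalgebra is $l$), and let $\bar X$ be the wonderful compactification of this symmetric space: the closure, in the grassmannian $\mathbb G(\dim\mathfrak g^\sigma,\mathfrak g)$, of the orbit of $\mathfrak g^\sigma$ under the adjoint group of $\mathfrak g$. Then for every $W\in\bar X$ the orthogonal $W^\perp$ for $\kappa$ has dimension $d$, the line $\bigwedge^dW^\perp$ lies in $N$, and $W\mapsto[\bigwedge^dW^\perp]$ is a closed embedding of the variety $\bar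 X$ into $\mathbb P(N)$, a projective space of smaller dimension than $\mathbb P(\bigwedge^d\mathfrak g)$. -/

import Mathlib

open Module LieAlgebra
open scoped LinearAlgebra.Projectivization

noncomputable section

namespace WonderfulLinear

/-! ### Projective varieties -/

section Projective

variable {V V' T : Type*} [AddCommGroup V] [Module ℂ V] [AddCommGroup V'] [Module ℂ V']

/-- The value at `v` of a polynomial in the linear forms on `V`. Taking all linear forms as
variables avoids the choice of coordinates. -/
def polyValue (p : MvPolynomial (Dual ℂ V) ℂ) (v : V) : ℂ :=
  MvPolynomial.eval (fun φ : Dual ℂ V => φ v) p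

/-- A subset of `ℙ(V)` is Zariski closed if it is the zero locus of a set of homogeneous
polynomials. -/
def IsZariskiClosed (Z : Set (ℙ ℂ V)) : Prop :=
  ∃ S : Set (MvPolynomial (Dual ℂ V) ℂ), (∀ p ∈ S, ∃ n, p.IsHomogeneous n) ∧
    Z = {x | ∀ p ∈ S, polyValue p x.rep = 0}

/-- The Zariski closure of a subset of `ℙ(V)`. -/
def zariskiClosure (S : Set (ℙ ℂ V)) : Set (ℙ ℂ V) :=
  ⋂₀ {Z | IsZariskiClosed Z ∧ S ⊆ Z}

/-- `F : V → V'` is a polynomial map, homogeneous of degree `n`. -/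
def IsHomogeneousMap (n : ℕ) (F : V → V') : Prop :=
  ∀ φ : Dual ℂ V', ∃ p : MvPolynomial (Dual ℂ V) ℂ, p.IsHomogeneous n ∧
    ∀ v, φ (F v) = polyValue p v

/-- For a set `T` of points, viewed as a subset of `ℙ(V)` through the coordinates `e : T → ℙ(V)`,
the map `f : T → ℙ(V')` is a morphism: in the neighbourhood of every point of `T` it is given by
homogeneous polynomials of one degree, in the homogeneous coordinates `e`. -/
def IsMorphism (e : T → ℙ ℂ V) (f : T → ℙ ℂ V') : Prop :=
  ∀ t : T, ∃ (n : ℕ) (F : V → V'), IsHomogeneousMap n F ∧ F (e t).rep ≠ 0 ∧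
    ∀ (t' : T) (h : F (e t').rep ≠ 0), f t' = Projectivization.mk ℂ (F (e t').rep) h

/-- For a projective variety `T`, with coordinates `e : T → ℙ(V)`, the map `f : T → ℙ(V')` is a
closed embedding: an isomorphism of `T` onto a Zariski closed subvariety of `ℙ(V')`.
The clause `IsMorphism f e` says that the inverse of `f`, from the image of `f` to `T`, is a
morphism. -/
structure IsClosedEmbedding (e : T → ℙ ℂ V) (f : T → ℙ ℂ V') : Prop where
  injective : Function.Injective f
  isClosed_range : IsZariskiClosed (Set.range f)
  isMorphism : IsMorphism e f
  isMorphism_inverse : IsMorphism f e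

end Projective

/-! ### The grassmannian -/

section Grassmannian

variable {V : Type*} [AddCommGroup V] [Module ℂ V] [FiniteDimensional ℂ V]

/-- The grassmannian `𝔾(n, V)` of `n`-dimensional subspaces of `V`. -/
abbrev Gr (n : ℕ) (V : Type*) [AddCommGroup V] [Module ℂ V] : Type _ :=
  {W : Submodule ℂ V // finrank ℂ W = n}

lemma finrank_range_map {n : ℕ} (W : Gr n V) :
    finrank ℂ (LinearMap.range (exteriorPower.map n W.1.subtype)) = 1 := by
  rw [LinearMap.finrank_range_of_inj
    (exteriorPower.map_injective_field W.1.injective_subtype),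
    exteriorPower.finrank_eq, W.2, Nat.choose_self]

/-- The Plücker coordinates of `W`: the line `⋀ⁿ W` in `⋀ⁿ V`. -/
def pluckerPoint {n : ℕ} (W : Gr n V) : ℙ ℂ (⋀[ℂ]^n V) :=
  Projectivization.mk'' (LinearMap.range (exteriorPower.map n W.1.subtype))
    (finrank_range_map W)

/-- The Zariski closure of a set of points of the grassmannian. -/
def grClosure {n : ℕ} (S : Set (Gr n V)) : Set (Gr n V) :=
  {W | pluckerPoint W ∈ zariskiClosure (pluckerPoint '' S)}

end Grassmannian

/-! ### The alternating form `w` and the operator `δ` -/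

section Lie

variable {𝔤 : Type*} [LieRing 𝔤] [LieAlgebra ℂ 𝔤]

/-- The trilinear form `w(x, y, z) = κ([x, y], z)`. -/
def trilin (x y z : 𝔤) : ℂ := killingForm ℂ 𝔤 ⁅x, y⁆ z

/-- The bilinear form on `⋀ⁿ 𝔤` induced by the Killing form:
`⟨a₁ ∧ ⋯ ∧ aₙ, b₁ ∧ ⋯ ∧ bₙ⟩ = det κ(aᵢ, bⱼ)`. -/
def killingPairing (n : ℕ) : ⋀[ℂ]^n 𝔤 →ₗ[ℂ] Dual ℂ (⋀[ℂ]^n 𝔤) :=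
  exteriorPower.pairingDual ℂ 𝔤 n ∘ₗ exteriorPower.map n (killingForm ℂ 𝔤)

variable [FiniteDimensional ℂ 𝔤]

/-- The form `w` as an element of `⋀³ 𝔤`, through the identification of `𝔤` with its dual by the
Killing form: in a basis `e` with dual basis `e'` for the Killing form,
`w = ∑_{i < j < k} w(eᵢ, eⱼ, eₖ) e'ᵢ ∧ e'ⱼ ∧ e'ₖ`. -/
def wElt [IsKilling ℂ 𝔤] : ⋀[ℂ]^3 𝔤 :=
  let e := Module.finBasis ℂ 𝔤
  let e' := (killingForm ℂ 𝔤).dualBasis (IsKilling.killingForm_nondegenerate ℂ 𝔤) e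
  (1 / 6 : ℂ) • ∑ i, ∑ j, ∑ k,
    trilin (e i) (e j) (e k) • exteriorPower.ιMulti ℂ 3 ![e' i, e' j, e' k]

/-- The operator `δ : ⋀ᵏ 𝔤 → ⋀ᵏ⁺³ 𝔤`, `η ↦ η ∧ w`. -/
def delta [IsKilling ℂ 𝔤] (k : ℕ) : ⋀[ℂ]^k 𝔤 →ₗ[ℂ] ⋀[ℂ]^(k + 3) 𝔤 where
  toFun η := ⟨η.1 * (wElt (𝔤 := 𝔤)).1, SetLike.mul_mem_graded η.2 wElt.2⟩
  map_add' _ _ := Subtype.ext (add_mul _ _ _)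
  map_smul' _ _ := Subtype.ext (smul_mul_assoc _ _ _)

/-! ### The sections of `I_Y(1)` -/

/-- A basis `e` of `𝔤` indexed by `Fin n ⊕ Fin m` gives an affine chart of `𝔾(n, 𝔤)`: the matrix `X`
is the point spanned by the vectors `xᵢ + ∑ⱼ Xᵢⱼ yⱼ`, where `xᵢ` and `yⱼ` are the two parts of `e`.
Up to the choice of bases this is `Hom(Λ, W)` with `Λ = ⟨xᵢ⟩` and `W = ⟨yⱼ⟩`. -/
def frame {n m : ℕ} (e : Basis (Fin n ⊕ Fin m) ℂ 𝔤) (X : Fin n × Fin m → ℂ) (i : Fin n) : 𝔤 :=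
  e (Sum.inl i) + ∑ j, X (i, j) • e (Sum.inr j)

/-- The coordinates of `xᵢ + ∑ⱼ Xᵢⱼ yⱼ` in the basis `e`, as polynomials in the `Xᵢⱼ`. -/
def frameCoord {n m : ℕ} (i : Fin n) : Fin n ⊕ Fin m → MvPolynomial (Fin n × Fin m) ℂ
  | Sum.inl j => if i = j then 1 else 0
  | Sum.inr j => MvPolynomial.X (i, j)

/-- The polynomial `w(v₁, v₂, v₃)` in the `Xᵢⱼ`, where `v₁`, `v₂`, `v₃` are the vectors
`xᵢ + ∑ⱼ Xᵢⱼ yⱼ` for `i = i₁, i₂, i₃`. -/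
def nullEquation {n m : ℕ} (e : Basis (Fin n ⊕ Fin m) ℂ 𝔤) (i₁ i₂ i₃ : Fin n) :
    MvPolynomial (Fin n × Fin m) ℂ :=
  ∑ a, ∑ b, ∑ c, MvPolynomial.C (trilin (e a) (e b) (e c)) *
    (frameCoord i₁ a * frameCoord i₂ b * frameCoord i₃ c)

/-- The ideal of `Y` in the chart of `e`, where `Y` is the scheme of nullspaces of `w` in
`𝔾(n, 𝔤)`: the image of `⋀³ K → 𝒪_𝔾`, the restriction of `w` to the tautological sheaf `K`. -/
def nullIdeal {n m : ℕ} (e : Basis (Fin n ⊕ Fin m) ℂ 𝔤) :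
    Ideal (MvPolynomial (Fin n × Fin m) ℂ) :=
  Ideal.span {P | ∃ i₁ i₂ i₃, P = nullEquation e i₁ i₂ i₃}

/-- The space `H⁰(I_Y(1))` of global sections on `𝔾(n, 𝔤)`. As `𝒪_𝔾(1)` is the dual of `⋀ⁿ K`, a
section of `𝒪_𝔾(1)` assigns to each point `Λ` an alternating `n`-form on `Λ`. It is a section of
`I_Y(1)` if in every affine chart, trivialized by the frame of `K`, it is given by an element of the
ideal of `Y`. -/
def sectionsIY (n : ℕ) : Submodule ℂ ((Λ : Gr n 𝔤) → Λ.1 [⋀^Fin n]→ₗ[ℂ] ℂ) where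
  carrier := {s | ∀ (m : ℕ) (e : Basis (Fin n ⊕ Fin m) ℂ 𝔤), ∃ P ∈ nullIdeal e,
    ∀ (X : Fin n × Fin m → ℂ) (Λ : Gr n 𝔤) (v : Fin n → Λ.1), (∀ i, (v i : 𝔤) = frame e X i) →
      s Λ v = MvPolynomial.eval X P}
  zero_mem' m e := ⟨0, zero_mem _, by intros; simp⟩
  add_mem' {s t} hs ht m e := by
    obtain ⟨P, hP, hs⟩ := hs m e
    obtain ⟨Q, hQ, ht⟩ := ht m e
    refine ⟨P + Q, add_mem hP hQ, fun X Λ v hv => ?_⟩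
    simp [hs X Λ v hv, ht X Λ v hv]
  smul_mem' c s hs m e := by
    obtain ⟨P, hP, hs⟩ := hs m e
    refine ⟨MvPolynomial.C c * P, Ideal.mul_mem_left _ _ hP, fun X Λ v hv => ?_⟩
    simp [hs X Λ v hv]

/-- The identification of the elements of `⋀ⁿ 𝔤` with sections of `𝒪_𝔾(1)` on `𝔾(n, 𝔤)`: by the
Killing form, `u` is an alternating form `(v₁, …, vₙ) ↦ ⟨u, v₁ ∧ ⋯ ∧ vₙ⟩`, to be restricted to each
subspace `Λ`. -/
def toSection (n : ℕ) : ⋀[ℂ]^n 𝔤 →ₗ[ℂ] ((Λ : Gr n 𝔤) → Λ.1 [⋀^Fin n]→ₗ[ℂ] ℂ) where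
  toFun u Λ := ((killingPairing n u).compAlternatingMap
    (exteriorPower.ιMulti ℂ n)).compLinearMap Λ.1.subtype
  map_add' _ _ := by ext; simp
  map_smul' _ _ := by ext; simp

/-- The linear subspace of `⋀ᵏ⁺³ 𝔤` defined by the equations in `δ(⋀ᵏ 𝔤)`. -/
def equationSpace [IsKilling ℂ 𝔤] (k : ℕ) : Submodule ℂ (⋀[ℂ]^(k + 3) 𝔤) :=
  ⨅ η : ⋀[ℂ]^k 𝔤, LinearMap.ker (killingPairing (k + 3) (delta k η))

/-! ### The wonderful compactification -/

/-- The adjoint group of a semisimple `𝔤`, generated by the `exp (ad x) = ∑ (ad x)ⁿ / n!` with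
`ad x` nilpotent. -/
def adjointGroup (𝔤 : Type*) [LieRing 𝔤] [LieAlgebra ℂ 𝔤] : Subgroup (𝔤 ≃ₗ[ℂ] 𝔤) :=
  Subgroup.closure {a | ∃ (x : 𝔤) (N : ℕ), ad ℂ 𝔤 x ^ N = 0 ∧
    (a : Module.End ℂ 𝔤) = ∑ n ∈ Finset.range N, ((n.factorial : ℂ)⁻¹) • ad ℂ 𝔤 x ^ n}

/-- The subspace `𝔤^σ` of fixed points. -/
def fixedSpace (σ : 𝔤 ≃ₗ⁅ℂ⁆ 𝔤) : Submodule ℂ 𝔤 :=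
  LinearMap.eqLocus (σ : 𝔤 →ₗ[ℂ] 𝔤) LinearMap.id

/-- The `-1`-eigenspace of `σ`. -/
def negSpace (σ : 𝔤 ≃ₗ⁅ℂ⁆ 𝔤) : Submodule ℂ 𝔤 :=
  LinearMap.eqLocus (σ : 𝔤 →ₗ[ℂ] 𝔤) (-LinearMap.id)

/-- The rank of the symmetric space of `σ`: the maximal dimension of the `-1`-eigenspace of `σ` on a
`σ`-invariant Cartan subalgebra. -/
def symmetricRank (σ : 𝔤 ≃ₗ⁅ℂ⁆ 𝔤) : ℕ :=
  sSup {r | ∃ H : LieSubalgebra ℂ 𝔤, H.IsCartanSubalgebra ∧ (∀ x ∈ H, σ x ∈ H) ∧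
    r = finrank ℂ (H.toSubmodule ⊓ negSpace σ : Submodule ℂ 𝔤)}

/-- The orbit of `𝔤^σ` under the adjoint group, in the grassmannian. -/
def symmetricOrbit (σ : 𝔤 ≃ₗ⁅ℂ⁆ 𝔤) : Set (Gr (finrank ℂ (fixedSpace σ)) 𝔤) :=
  {W | ∃ a ∈ adjointGroup 𝔤, W.1 = (fixedSpace σ).map (a : 𝔤 →ₗ[ℂ] 𝔤)}

/-- The minimal wonderful compactification of the symmetric space of `σ`. -/
def wonderful (σ : 𝔤 ≃ₗ⁅ℂ⁆ 𝔤) : Set (Gr (finrank ℂ (fixedSpace σ)) 𝔤) :=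
  grClosure (symmetricOrbit σ)

end Lie

end WonderfulLinear

end

/-! As an alternating form, `δ(a₁ ∧ ⋯ ∧ aₖ)` is, up to a constant, the antisymmetrization of `κ(a₁,
·) ⋯ κ(aₖ, ·) w` (`killingPairing_delta_ιMulti`). Every term contains a value of `w` on three of the
arguments. So on a frame of `Λ` it is a combination of the equations of `Y`, and it vanishes on
every nullspace of `w`, whose Plücker point therefore lies in `ℙ(N)`. The subspace `N` is proper
because `w ≠ 0` and the wedge pairing is perfect, so that `δ ≠ 0`.

Let `𝔨` and `𝔭` be the eigenspaces of `σ` for `1` and `-1`. Then `𝔨^⊥ = 𝔭`, and `w` vanishes on `𝔭`,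
since `σ` preserves `w` while three signs reverse it. The adjoint group preserves `κ` and `w`, so
`W^⊥` is a nullspace for every `W` in the orbit of `𝔨`. In Plücker coordinates `W ↦ W^⊥` is the
Hodge star, a linear isomorphism: containment in the linear space `ℙ(N)` passes to the closure, and
the map is a closed embedding because the Plücker image of the closure is closed.

It remains to see that `dim 𝔭 = d`. Maximal rank gives a Cartan subalgebra `H ⊆ 𝔭`; for `x ∈ H` with
Engel subalgebra `H`, `ad x` maps `𝔭` onto `𝔨` with kernel `H`. This uses `dim H = l` for every
Cartan subalgebra (`finrank_cartan_eq_rank`), where `l` is defined by the generic characteristic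
polynomial of `ad`. -/

open Module LieAlgebra
open scoped LinearAlgebra.Projectivization

noncomputable section

namespace WonderfulLinear

/-! ### Zariski closed sets and linear maps of projective spaces -/

section Projective

variable {V V' T : Type*} [AddCommGroup V] [Module ℂ V] [AddCommGroup V'] [Module ℂ V']

lemma polyValue_smul {p : MvPolynomial (Dual ℂ V) ℂ} {n : ℕ} (hp : p.IsHomogeneous n)
    (c : ℂ) (v : V) : polyValue p (c • v) = c ^ n * polyValue p v := by
  simp only [polyValue, MvPolynomial.eval_eq, Finset.mul_sum]
  refine Finset.sum_congr rfl fun d hd => ?_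
  have hdeg : d.degree = n := by
    by_contra h
    exact MvPolynomial.mem_support_iff.1 hd (hp.coeff_eq_zero h)
  simp only [map_smul, smul_eq_mul, mul_pow, Finset.prod_mul_distrib, Finset.prod_pow_eq_pow_sum]
  rw [← hdeg, Finsupp.degree_apply]
  ring

lemma polyValue_rep_mk_eq_zero {p : MvPolynomial (Dual ℂ V) ℂ} {n : ℕ} (hp : p.IsHomogeneous n)
    (v : V) (hv : v ≠ 0) :
    polyValue p (Projectivization.mk ℂ v hv).rep = 0 ↔ polyValue p v = 0 := by
  obtain ⟨a, ha⟩ := Projectivization.exists_smul_eq_mk_rep ℂ v hv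
  rw [← ha, Units.smul_def, polyValue_smul hp]
  simp

lemma polyValue_rename (ψ : V →ₗ[ℂ] V') (p : MvPolynomial (Dual ℂ V') ℂ) (v : V) :
    polyValue (MvPolynomial.rename ψ.dualMap p) v = polyValue p (ψ v) := by
  simp only [polyValue, MvPolynomial.eval_rename]
  rfl

lemma IsZariskiClosed.preimage_map {Z : Set (ℙ ℂ V')} (hZ : IsZariskiClosed Z)
    (ψ : V →ₗ[ℂ] V') (hψ : Function.Injective ψ) :
    IsZariskiClosed (Projectivization.map ψ hψ ⁻¹' Z) := by
  obtain ⟨S, hS, rfl⟩ := hZ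
  refine ⟨MvPolynomial.rename ψ.dualMap '' S, ?_, ?_⟩
  · rintro _ ⟨p, hp, rfl⟩
    obtain ⟨n, hn⟩ := hS p hp
    exact ⟨n, hn.rename_isHomogeneous⟩
  · ext x
    simp only [Set.mem_preimage, Set.mem_ofPred_eq, Set.forall_mem_image]
    refine forall₂_congr fun p hp => ?_
    obtain ⟨n, hn⟩ := hS p hp
    conv_lhs => rw [← x.mk_rep, Projectivization.map_mk]
    rw [polyValue_rep_mk_eq_zero hn, polyValue_rename]

lemma zariskiClosure_subset {S Z : Set (ℙ ℂ V)} (hZ : IsZariskiClosed Z) (h : S ⊆ Z) :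
    zariskiClosure S ⊆ Z :=
  Set.sInter_subset_of_mem ⟨hZ, h⟩

/-- The homogeneous polynomials vanishing on `S`, taken all together, cut out the closure. -/
lemma isZariskiClosed_zariskiClosure (S : Set (ℙ ℂ V)) : IsZariskiClosed (zariskiClosure S) := by
  refine ⟨{p | (∃ n, p.IsHomogeneous n) ∧ ∀ x ∈ S, polyValue p x.rep = 0}, fun p hp => hp.1,
    Set.Subset.antisymm ?_ ?_⟩
  · refine zariskiClosure_subset ⟨_, fun p hp => hp.1, rfl⟩ fun x hx p hp => hp.2 x hx
  · rintro x hx _ ⟨⟨Q, hQ, rfl⟩, hSZ⟩ q hq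
    exact hx q ⟨hQ q hq, fun y hy => hSZ hy q hq⟩

lemma isHomogeneousMap_linear (F : V →ₗ[ℂ] V') : IsHomogeneousMap 1 F := fun φ =>
  ⟨MvPolynomial.X (φ ∘ₗ F), MvPolynomial.isHomogeneous_X _ _, fun v => by simp [polyValue]⟩

lemma isMorphism_of_linear {e : T → ℙ ℂ V} {f : T → ℙ ℂ V'} (F : V →ₗ[ℂ] V')
    (h : ∀ t, ∃ h : F (e t).rep ≠ 0, f t = Projectivization.mk ℂ _ h) : IsMorphism e f :=
  fun t => ⟨1, F, isHomogeneousMap_linear F, (h t).1, fun t' _ => (h t').2⟩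

/-- A lift of an embedding of a projective variety through an injective linear map is a closed
embedding. -/
lemma isClosedEmbedding_of_map_eq {e : T → ℙ ℂ V} {f : T → ℙ ℂ V'}
    (he : Function.Injective e) (hcl : IsZariskiClosed (Set.range e))
    (B : V' →ₗ[ℂ] V) (hB : Function.Injective B)
    (hf : ∀ t, Projectivization.map B hB (f t) = e t) : IsClosedEmbedding e f := by
  have hrange : Set.range f = Projectivization.map B hB ⁻¹' Set.range e := by
    ext y
    constructor
    · rintro ⟨t, rfl⟩
      exact ⟨t, (hf t).symm⟩
    · rintro ⟨t, ht⟩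
      exact ⟨t, Projectivization.map_injective B hB ((hf t).trans ht)⟩
  have hmk : ∀ t, ∃ h : B (f t).rep ≠ 0, e t = Projectivization.mk ℂ _ h := fun t =>
    ⟨fun h0 => (f t).rep_nonzero (hB (h0.trans (map_zero B).symm)), by
      conv_lhs => rw [← hf t, ← (f t).mk_rep, Projectivization.map_mk]⟩
  -- A linear left inverse `A` of `B` expresses `f` in the coordinates `e`, and `B` expresses the
  -- inverse; both are of degree one and defined at every point.
  obtain ⟨A, hA⟩ := B.exists_leftInverse_of_injective (LinearMap.ker_eq_bot.2 hB)
  refine ⟨fun s t hst => he (by rw [← hf, ← hf, hst]), hrange ▸ hcl.preimage_map B hB,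
    isMorphism_of_linear A fun t => ?_, isMorphism_of_linear B hmk⟩
  obtain ⟨h, ht⟩ := hmk t
  obtain ⟨a, ha⟩ := Projectivization.exists_smul_eq_mk_rep ℂ _ h
  have hAe : A (e t).rep = a • (f t).rep := by
    rw [ht, ← ha, Units.smul_def, map_smul, ← LinearMap.comp_apply, hA]
    rfl
  have hne : A (e t).rep ≠ 0 := by
    rw [hAe]
    exact (smul_ne_zero_iff_ne a).2 (f t).rep_nonzero
  refine ⟨hne, ?_⟩
  conv_lhs => rw [← (f t).mk_rep]
  rw [eq_comm, Projectivization.mk_eq_mk_iff]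
  exact ⟨a, hAe.symm⟩

end Projective

/-! ### Radicals of alternating forms and the Plücker relations -/

section AlternatingForms

variable {K V : Type*} [Field K] [AddCommGroup V] [Module K V] {n : ℕ}

/-- The radical of an alternating form: the vectors whose contraction with the form is zero. -/
def radical (f : V [⋀^Fin n]→ₗ[K] K) : Submodule K V where
  carrier := {c | ∀ u i, f (Function.update u i c) = 0}
  zero_mem' u i := f.map_update_zero u i
  add_mem' ha hb u i := by rw [f.map_update_add, ha, hb, add_zero]
  smul_mem' c a ha u i := by rw [f.map_update_smul, ha, smul_zero]

lemma le_radical_iff {f : V [⋀^Fin n]→ₗ[K] K} {U : Submodule K V} :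
    U ≤ radical f ↔ ∀ v i, v i ∈ U → f v = 0 := by
  refine ⟨fun h v i hv => ?_, fun h c hc u i => h _ i (by simpa using hc)⟩
  simpa using h hv v i

lemma map_eq_of_sub_mem_radical (f : V [⋀^Fin n]→ₗ[K] K) {v v' : Fin n → V}
    (h : ∀ i, v i - v' i ∈ radical f) : f v = f v' := by
  have key : ∀ s : Finset (Fin n), f (s.piecewise v' v) = f v := by
    intro s
    induction s using Finset.induction with
    | empty => simp
    | insert i s hi ih =>
      rw [Finset.piecewise_insert, ← ih]
      have h1 := h i (s.piecewise v' v) i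
      rw [f.map_update_sub, sub_eq_zero] at h1
      rw [← h1, ← s.piecewise_eq_of_notMem v' v hi, Function.update_eq_self]
  rw [← key Finset.univ, Finset.piecewise_univ]

/-- Cramer's rule modulo the radical: the terms with `j ≠ i` repeat the vector `v j`. -/
lemma map_update_sum_smul_add (f : V [⋀^Fin n]→ₗ[K] K) (v : Fin n → V) (a : Fin n → K) {r : V}
    (hr : r ∈ radical f) (i : Fin n) :
    f (Function.update v i (∑ j, a j • v j + r)) = a i * f v := by
  rw [f.map_update_add, hr, add_zero, f.map_update_sum, Finset.sum_eq_single i]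
  · simp
  · intro j _ hj
    rw [f.map_update_smul, f.map_update_self v hj.symm, smul_zero]
  · simp

lemma linearIndependent_mkQ_radical {f : V [⋀^Fin n]→ₗ[K] K} {v : Fin n → V} (hv : f v ≠ 0) :
    LinearIndependent K ((radical f).mkQ ∘ v) := by
  rw [Fintype.linearIndependent_iff]
  intro a ha i
  have hmem : ∑ j, a j • v j ∈ radical f := by
    rw [← Submodule.Quotient.mk_eq_zero, ← Submodule.mkQ_apply, map_sum]
    simpa using ha
  have h1 := map_update_sum_smul_add f v a (Submodule.zero_mem _) i
  rw [add_zero, hmem v i] at h1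
  exact (mul_eq_zero.1 h1.symm).resolve_right hv

variable [FiniteDimensional K V]

/-- A tuple with `f v ≠ 0` is independent modulo the radical. Equality characterizes the
decomposable forms, that is, the points of the grassmannian. -/
lemma finrank_radical_add_le {f : V [⋀^Fin n]→ₗ[K] K} (hf : f ≠ 0) :
    finrank K (radical f) + n ≤ finrank K V := by
  obtain ⟨v, hv⟩ : ∃ v, f v ≠ 0 := by
    by_contra! h
    exact hf (AlternatingMap.ext h)
  have := (linearIndependent_mkQ_radical hv).fintype_card_le_finrank
  rw [Fintype.card_fin] at this
  have := (radical f).finrank_quotient_add_finrank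
  omega

/-- Alternating `n`-forms whose radical contains a given subspace of codimension `n` are
proportional. -/
lemma exists_eq_smul_of_le_radical {f f' : V [⋀^Fin n]→ₗ[K] K} {U : Submodule K V}
    (hU : finrank K V ≤ finrank K U + n) (hf : U ≤ radical f) (hf' : U ≤ radical f')
    (hne : f' ≠ 0) : ∃ c : K, f = c • f' := by
  have hn : finrank K V = finrank K U + n :=
    le_antisymm hU ((Nat.add_le_add_right (Submodule.finrank_mono hf') n).trans
      (finrank_radical_add_le hne))
  obtain ⟨U', hU'⟩ := U.exists_isCompl
  have hfin : finrank K U' = n := by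
    have := Submodule.finrank_add_eq_of_isCompl hU'
    omega
  let b : Basis (Fin n) K U' := (finBasis K U').reindex (finCongr hfin)
  -- Such a form lives on `V / U`, of dimension `n`, so a single value determines it.
  have key : ∀ g : V [⋀^Fin n]→ₗ[K] K, U ≤ radical g → g (fun i => (b i : V)) = 0 → g = 0 := by
    intro g hg h0
    ext v
    choose u hu w hw huw using fun i =>
      Submodule.mem_sup.1 ((hU'.sup_eq_top ▸ Submodule.mem_top : v i ∈ U ⊔ U'))
    have h1 : g v = g fun i => ((⟨w i, hw i⟩ : U') : V) :=
      map_eq_of_sub_mem_radical g fun i => hg (by simpa [← huw i] using hu i)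
    have h2 := (g.compLinearMap U'.subtype).eq_smul_basis_det b
    have h3 : (g.compLinearMap U'.subtype) b = 0 := h0
    rw [h3, zero_smul] at h2
    rw [h1]
    exact DFunLike.congr_fun h2 fun i => ⟨w i, hw i⟩
  set x : Fin n → V := fun i => (b i : V)
  have hx : f' x ≠ 0 := fun h => hne (key f' hf' h)
  refine ⟨f x / f' x, sub_eq_zero.1 (key _ ?_ ?_)⟩
  · rw [le_radical_iff] at hf hf' ⊢
    intro v i hv
    simp [hf v i hv, hf' v i hv]
  · simp [hx]

/-- The Plücker relations of an alternating form, multiplied by a value of the form. -/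
def pluckerRelation (f : V [⋀^Fin n]→ₗ[K] K) (v u : Fin n → V) (i : Fin n) (c : V) : K :=
  f v * (f v * f (Function.update u i c) -
    ∑ j, f (Function.update v j c) * f (Function.update u i (v j)))

/-- The factor `f v` disposes of the case `f v = 0`. Otherwise `v` is a basis modulo the radical,
and the relation is the expansion of `c` in it by Cramer's rule. -/
lemma pluckerRelation_eq_zero {f : V [⋀^Fin n]→ₗ[K] K}
    (hf : finrank K V ≤ finrank K (radical f) + n) (v u : Fin n → V) (i : Fin n) (c : V) :
    pluckerRelation f v u i c = 0 := by
  rw [pluckerRelation]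
  by_cases hv : f v = 0
  · rw [hv, zero_mul]
  have hli := linearIndependent_mkQ_radical hv
  have hspan := hli.span_eq_top_of_card_eq_finrank' (by
    have h1 := hli.fintype_card_le_finrank
    have h2 := (radical f).finrank_quotient_add_finrank
    rw [Fintype.card_fin] at h1 ⊢
    omega)
  obtain ⟨a, ha⟩ := (Submodule.mem_span_range_iff_exists_fun K).1
    (hspan ▸ Submodule.mem_top : (radical f).mkQ c ∈ _)
  have hr : c - ∑ j, a j • v j ∈ radical f := by
    rw [← Submodule.Quotient.mk_eq_zero, ← Submodule.mkQ_apply, map_sub, ← ha, map_sum]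
    simp
  have hc : c = ∑ j, a j • v j + (c - ∑ j, a j • v j) := by abel
  have h1 : ∀ j, f (Function.update v j c) = a j * f v := fun j => by
    conv_lhs => rw [hc]
    exact map_update_sum_smul_add f v a hr j
  have h2 : f (Function.update u i c) = ∑ j, a j * f (Function.update u i (v j)) := by
    conv_lhs => rw [hc]
    rw [f.map_update_add, hr u i, add_zero, f.map_update_sum]
    simp
  simp_rw [h1, h2, Finset.mul_sum]
  rw [sub_eq_zero.2 (Finset.sum_congr rfl fun j _ => by ring), mul_zero]

/-- For fixed `v` with `f v ≠ 0`, the relations say that `c` minus its Cramer expansion in `v` is in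
the radical. So `v` spans modulo the radical. -/
lemma finrank_le_of_pluckerRelation_eq_zero {f : V [⋀^Fin n]→ₗ[K] K} (hf : f ≠ 0)
    (h : ∀ v u i c, pluckerRelation f v u i c = 0) :
    finrank K V ≤ finrank K (radical f) + n := by
  obtain ⟨v, hv⟩ : ∃ v, f v ≠ 0 := by
    by_contra! h
    exact hf (AlternatingMap.ext h)
  have htop : Submodule.span K (Set.range v) ⊔ radical f = ⊤ := by
    refine eq_top_iff.2 fun c _ => ?_
    let s := ∑ j, ((f v)⁻¹ * f (Function.update v j c)) • v j
    have hs : s ∈ Submodule.span K (Set.range v) :=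
      Submodule.sum_mem _ fun j _ =>
        Submodule.smul_mem _ _ (Submodule.subset_span (Set.mem_range_self j))
    refine Submodule.mem_sup.2 ⟨s, hs, c - s, fun u i => ?_, by abel⟩
    have h1 := (mul_eq_zero.1 (h v u i c)).resolve_left hv
    have h2 : f (Function.update u i s) =
        (f v)⁻¹ * ∑ j, f (Function.update v j c) * f (Function.update u i (v j)) := by
      rw [f.map_update_sum, Finset.mul_sum]
      simp [mul_assoc]
    rw [f.map_update_sub, h2, ← sub_eq_zero.1 h1, inv_mul_cancel_left₀ hv, sub_self]
  have h1 := Submodule.finrank_add_le_finrank_add_finrank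
    (Submodule.span K (Set.range v)) (radical f)
  have h2 := finrank_range_le_card (R := K) v
  rw [htop, finrank_top] at h1
  rw [Fintype.card_fin, Set.finrank] at h2
  omega

end AlternatingForms

/-! ### The Plücker embedding through the Killing form -/

section Plucker

variable {𝔤 : Type*} [LieRing 𝔤] [LieAlgebra ℂ 𝔤]

lemma killingForm_isRefl : (killingForm ℂ 𝔤).IsRefl := fun x y h => by
  rw [LieModule.traceForm_comm, h]

/-- The pairing has the identity matrix in the bases of exterior powers induced by a basis and its
dual basis. -/
lemma pairingDual_injective (V : Type*) [AddCommGroup V] [Module ℂ V] [FiniteDimensional ℂ V]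
    (n : ℕ) : Function.Injective (exteriorPower.pairingDual ℂ V n) := by
  let b := finBasis ℂ V
  let B := b.dualBasis.exteriorPower n
  rw [← LinearMap.ker_eq_bot, LinearMap.ker_eq_bot']
  intro x hx
  refine B.ext_elem fun s => ?_
  have key : ∀ y, exteriorPower.pairingDual ℂ V n y (exteriorPower.ιMulti_family ℂ n b s) =
      B.repr y s := by
    intro y
    suffices h : (exteriorPower.pairingDual ℂ V n).flip (exteriorPower.ιMulti_family ℂ n b s) =
        B.coord s from LinearMap.congr_fun h y
    refine B.ext fun t => ?_
    rw [Basis.coord_apply, Basis.repr_self, LinearMap.flip_apply, exteriorPower.basis_apply,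
      Basis.coe_dualBasis]
    change exteriorPower.ιMultiDual ℂ n b t _ = _
    by_cases hst : t = s
    · subst hst
      rw [exteriorPower.ιMultiDual_apply_diag, Finsupp.single_eq_same]
    · rw [exteriorPower.ιMultiDual_apply_nondiag _ _ _ _ _ hst, Finsupp.single_eq_of_ne' hst]
  rw [← key, hx]
  simp

lemma killingPairing_ιMulti_ιMulti {n : ℕ} (a v : Fin n → 𝔤) :
    killingPairing n (exteriorPower.ιMulti ℂ n a) (exteriorPower.ιMulti ℂ n v) =
      Matrix.det (.of fun i j => killingForm ℂ 𝔤 (a j) (v i)) := by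
  simp [killingPairing, exteriorPower.pairingDual_ιMulti_ιMulti]

lemma range_map_subtype_eq_span {n : ℕ} (W : Submodule ℂ 𝔤) :
    LinearMap.range (exteriorPower.map n W.subtype) =
      Submodule.span ℂ (Set.range fun w : Fin n → W =>
        exteriorPower.ιMulti ℂ n fun i => (w i : 𝔤)) := by
  rw [LinearMap.range_eq_map, ← exteriorPower.ιMulti_span, Submodule.map_span, ← Set.range_comp]
  congr 2
  ext w
  simp [Function.comp_def]

/-- The Plücker relations as polynomials on `⋀ⁿ 𝔤`. -/
def pluckerPolynomial {n : ℕ} (v u : Fin n → 𝔤) (i : Fin n) (c : 𝔤) :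
    MvPolynomial (Dual ℂ (⋀[ℂ]^n 𝔤)) ℂ :=
  let X (w : Fin n → 𝔤) : MvPolynomial (Dual ℂ (⋀[ℂ]^n 𝔤)) ℂ :=
    MvPolynomial.X ((killingPairing n).flip (exteriorPower.ιMulti ℂ n w))
  X v * (X v * X (Function.update u i c) -
    ∑ j, X (Function.update v j c) * X (Function.update u i (v j)))

lemma isHomogeneous_pluckerPolynomial {n : ℕ} (v u : Fin n → 𝔤) (i : Fin n) (c : 𝔤) :
    (pluckerPolynomial v u i c).IsHomogeneous 3 := by
  have h2 : ∀ φ ψ : Dual ℂ (⋀[ℂ]^n 𝔤),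
      (MvPolynomial.X φ * MvPolynomial.X ψ : MvPolynomial _ ℂ).IsHomogeneous 2 :=
    fun φ ψ => (MvPolynomial.isHomogeneous_X ℂ φ).mul (MvPolynomial.isHomogeneous_X ℂ ψ)
  exact (MvPolynomial.isHomogeneous_X ℂ _).mul
    ((h2 _ _).sub (MvPolynomial.IsHomogeneous.sum _ _ _ fun j _ => h2 _ _))

variable [FiniteDimensional ℂ 𝔤] [IsKilling ℂ 𝔤]

lemma killingPairing_injective (n : ℕ) : Function.Injective (killingPairing (𝔤 := 𝔤) n) :=
  (pairingDual_injective 𝔤 n).comp (exteriorPower.map_injective_field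
    (LinearMap.ker_eq_bot.1 (IsKilling.ker_killingForm_eq_bot ℂ 𝔤)))

/-- The Killing form identifies `⋀ⁿ 𝔤` with its dual. -/
def killingPairingEquiv (n : ℕ) : ⋀[ℂ]^n 𝔤 ≃ₗ[ℂ] Dual ℂ (⋀[ℂ]^n 𝔤) :=
  LinearEquiv.ofBijective (killingPairing n) ⟨killingPairing_injective n,
    (LinearMap.injective_iff_surjective_of_finrank_eq_finrank
      (Subspace.dual_finrank_eq (K := ℂ)).symm).1 (killingPairing_injective n)⟩

/-- The alternating form on `𝔤` corresponding to an element of `⋀ⁿ 𝔤` under the Killing form. -/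
def altForm (n : ℕ) : ⋀[ℂ]^n 𝔤 ≃ₗ[ℂ] (𝔤 [⋀^Fin n]→ₗ[ℂ] ℂ) :=
  (killingPairingEquiv n).trans exteriorPower.alternatingMapLinearEquiv.symm

lemma altForm_apply {n : ℕ} (ω : ⋀[ℂ]^n 𝔤) (v : Fin n → 𝔤) :
    altForm n ω v = killingPairing n ω (exteriorPower.ιMulti ℂ n v) := by
  simp only [altForm, LinearEquiv.trans_apply, exteriorPower.alternatingMapLinearEquiv_symm_apply,
    LinearMap.compAlternatingMap_apply]
  rfl

lemma altForm_ιMulti {n : ℕ} (a v : Fin n → 𝔤) :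
    altForm n (exteriorPower.ιMulti ℂ n a) v =
      Matrix.det (.of fun i j => killingForm ℂ 𝔤 (a j) (v i)) := by
  rw [altForm_apply, killingPairing_ιMulti_ιMulti]

lemma finrank_add_finrank_orthogonal (W : Submodule ℂ 𝔤) :
    finrank ℂ W + finrank ℂ ((killingForm ℂ 𝔤).orthogonal W) = finrank ℂ 𝔤 := by
  rw [LinearMap.BilinForm.finrank_orthogonal (IsKilling.killingForm_nondegenerate ℂ 𝔤)]
  have := W.finrank_le
  omega

lemma orthogonal_orthogonal (W : Submodule ℂ 𝔤) :
    (killingForm ℂ 𝔤).orthogonal ((killingForm ℂ 𝔤).orthogonal W) = W :=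
  LinearMap.BilinForm.orthogonal_orthogonal (IsKilling.killingForm_nondegenerate ℂ 𝔤)
    killingForm_isRefl W

lemma orthogonal_le_radical {n : ℕ} {W : Submodule ℂ 𝔤} {ω : ⋀[ℂ]^n 𝔤}
    (hω : ω ∈ LinearMap.range (exteriorPower.map n W.subtype)) :
    (killingForm ℂ 𝔤).orthogonal W ≤ radical (altForm n ω) := by
  rw [le_radical_iff]
  intro v i hv
  rw [range_map_subtype_eq_span] at hω
  induction hω using Submodule.span_induction with
  | mem x hx =>
    obtain ⟨w, rfl⟩ := hx
    rw [altForm_ιMulti]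
    exact Matrix.det_eq_zero_of_row_eq_zero i fun j => hv _ (w j).2
  | zero => simp
  | add x y _ _ hx hy => simp [hx, hy]
  | smul c x _ hx => simp [hx]

/-- The dictionary between points of the grassmannian and radicals. As `W^⊥` has codimension `n`,
the forms whose radical contains it make up a single line. -/
lemma mem_submodule_pluckerPoint_iff {n : ℕ} (W : Gr n 𝔤) (ω : ⋀[ℂ]^n 𝔤) :
    ω ∈ (pluckerPoint W).submodule ↔
      (killingForm ℂ 𝔤).orthogonal W.1 ≤ radical (altForm n ω) := by
  rw [pluckerPoint, Projectivization.submodule_mk'']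
  refine ⟨orthogonal_le_radical, fun h => ?_⟩
  obtain ⟨ω₀, hω₀, hne⟩ := Submodule.exists_mem_ne_zero_of_ne_bot
    (p := LinearMap.range (exteriorPower.map n W.1.subtype))
    (fun h0 => by have := finrank_range_map W; rw [h0, finrank_bot] at this; omega)
  have hdim := finrank_add_finrank_orthogonal W.1
  rw [W.2] at hdim
  obtain ⟨c, hc⟩ := exists_eq_smul_of_le_radical (by omega) h (orthogonal_le_radical hω₀)
    (fun h0 => hne ((altForm n).injective (h0.trans (map_zero _).symm)))
  rw [← map_smul, (altForm n).injective.eq_iff] at hc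
  exact hc ▸ Submodule.smul_mem _ _ hω₀

lemma radical_altForm_eq_orthogonal {n : ℕ} {W : Gr n 𝔤} {ω : ⋀[ℂ]^n 𝔤} (hω : ω ≠ 0)
    (h : ω ∈ (pluckerPoint W).submodule) :
    radical (altForm n ω) = (killingForm ℂ 𝔤).orthogonal W.1 := by
  symm
  refine Submodule.eq_of_le_of_finrank_le ((mem_submodule_pluckerPoint_iff W ω).1 h) ?_
  have h1 := finrank_add_finrank_orthogonal W.1
  have h2 := finrank_radical_add_le (f := altForm n ω)
    (fun h0 => hω ((altForm n).injective (h0.trans (map_zero _).symm)))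
  rw [W.2] at h1
  omega

lemma rep_mem_submodule {V : Type*} [AddCommGroup V] [Module ℂ V] (x : ℙ ℂ V) :
    x.rep ∈ x.submodule := by
  rw [x.submodule_eq]
  exact Submodule.mem_span_singleton_self _

lemma eq_of_mem_submodule {V : Type*} [AddCommGroup V] [Module ℂ V] {x y : ℙ ℂ V} {v : V}
    (hv : v ≠ 0) (hx : v ∈ x.submodule) (hy : v ∈ y.submodule) : x = y := by
  have h : ∀ z : ℙ ℂ V, v ∈ z.submodule → z = Projectivization.mk ℂ v hv := by
    intro z hz
    rw [z.submodule_eq, Submodule.mem_span_singleton] at hz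
    obtain ⟨a, ha⟩ := hz
    rw [← z.mk_rep, eq_comm, Projectivization.mk_eq_mk_iff']
    exact ⟨a, ha⟩
  rw [h x hx, h y hy]

lemma pluckerPoint_injective {n : ℕ} : Function.Injective (pluckerPoint (V := 𝔤) (n := n)) := by
  intro W W' h
  have h1 := radical_altForm_eq_orthogonal (pluckerPoint W).rep_nonzero (rep_mem_submodule _)
  have h2 := radical_altForm_eq_orthogonal (pluckerPoint W').rep_nonzero (rep_mem_submodule _)
  rw [← h, h1] at h2
  exact Subtype.ext (by rw [← orthogonal_orthogonal W.1, h2, orthogonal_orthogonal])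

lemma exists_pluckerPoint_eq {n : ℕ} {x : ℙ ℂ (⋀[ℂ]^n 𝔤)} {ω : ⋀[ℂ]^n 𝔤} (hω : ω ≠ 0)
    (hx : ω ∈ x.submodule) (h : finrank ℂ 𝔤 ≤ finrank ℂ (radical (altForm n ω)) + n) :
    ∃ W : Gr n 𝔤, pluckerPoint W = x := by
  have h1 := finrank_add_finrank_orthogonal (radical (altForm n ω))
  have h2 := finrank_radical_add_le (f := altForm n ω)
    (fun h0 => hω ((altForm n).injective (h0.trans (map_zero _).symm)))
  refine ⟨⟨(killingForm ℂ 𝔤).orthogonal (radical (altForm n ω)), by omega⟩,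
    eq_of_mem_submodule hω ?_ hx⟩
  rw [mem_submodule_pluckerPoint_iff, orthogonal_orthogonal]

lemma polyValue_pluckerPolynomial {n : ℕ} (v u : Fin n → 𝔤) (i : Fin n) (c : 𝔤)
    (ω : ⋀[ℂ]^n 𝔤) :
    polyValue (pluckerPolynomial v u i c) ω = pluckerRelation (altForm n ω) v u i c := by
  simp [polyValue, pluckerPolynomial, pluckerRelation, altForm_apply]

/-- The grassmannian is Zariski closed in its Plücker embedding. -/
lemma isZariskiClosed_range_pluckerPoint (n : ℕ) :
    IsZariskiClosed (Set.range (pluckerPoint (V := 𝔤) (n := n))) := by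
  refine ⟨{p | ∃ v u i c, p = pluckerPolynomial v u i c}, ?_, ?_⟩
  · rintro _ ⟨v, u, i, c, rfl⟩
    exact ⟨3, isHomogeneous_pluckerPolynomial v u i c⟩
  · ext x
    constructor
    · rintro ⟨W, rfl⟩ _ ⟨v, u, i, c, rfl⟩
      rw [polyValue_pluckerPolynomial]
      refine pluckerRelation_eq_zero ?_ v u i c
      rw [radical_altForm_eq_orthogonal (pluckerPoint W).rep_nonzero (rep_mem_submodule _)]
      have := finrank_add_finrank_orthogonal W.1
      rw [W.2] at this
      omega
    · intro h
      refine exists_pluckerPoint_eq x.rep_nonzero (rep_mem_submodule x) ?_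
      refine finrank_le_of_pluckerRelation_eq_zero
        (fun h0 => x.rep_nonzero ((altForm n).injective (h0.trans (map_zero _).symm))) ?_
      intro v u i c
      rw [← polyValue_pluckerPolynomial]
      exact h _ ⟨v, u, i, c, rfl⟩

/-- The grassmannian is closed, so the closure in projective space adds no points outside it. -/
lemma zariskiClosure_image_pluckerPoint {n : ℕ} (S : Set (Gr n 𝔤)) :
    zariskiClosure (pluckerPoint '' S) = pluckerPoint '' grClosure S := by
  refine Set.Subset.antisymm (fun x hx => ?_) ?_
  · obtain ⟨W, rfl⟩ := zariskiClosure_subset (isZariskiClosed_range_pluckerPoint n)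
      (Set.image_subset_range _ _) hx
    exact ⟨W, hx, rfl⟩
  · rintro _ ⟨W, hW, rfl⟩
    exact hW

end Plucker

/-! ### The Hodge star, which is `W ↦ W^⊥` in Plücker coordinates -/

section Star

variable {𝔤 : Type*} [LieRing 𝔤] [LieAlgebra ℂ 𝔤] {n m : ℕ}

/-- A linear functional on the exterior algebra that sends `v₁ ∧ ⋯ ∧ vₙ₊ₘ` to the determinant in the
basis `e`. -/
def volume (e : Basis (Fin (n + m)) ℂ 𝔤) : ExteriorAlgebra ℂ 𝔤 →ₗ[ℂ] ℂ :=
  ExteriorAlgebra.liftAlternating (Function.update 0 (n + m) e.det)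

/-- The pairing `(ω, η) ↦ vol(ω ∧ η)` of `⋀ⁿ 𝔤` and `⋀ᵐ 𝔤`. -/
def wedgePairing (e : Basis (Fin (n + m)) ℂ 𝔤) : ⋀[ℂ]^n 𝔤 →ₗ[ℂ] Dual ℂ (⋀[ℂ]^m 𝔤) :=
  ((LinearMap.mul ℂ (ExteriorAlgebra ℂ 𝔤)).compr₂ (volume e)).compl₁₂
    (⋀[ℂ]^n 𝔤).subtype (⋀[ℂ]^m 𝔤).subtype

lemma wedgePairing_ιMulti (e : Basis (Fin (n + m)) ℂ 𝔤) (w : Fin n → 𝔤) (v : Fin m → 𝔤) :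
    wedgePairing e (exteriorPower.ιMulti ℂ n w) (exteriorPower.ιMulti ℂ m v) =
      e.det (Fin.append w v) := by
  simp only [wedgePairing, LinearMap.compl₁₂_apply, LinearMap.compr₂_apply, Submodule.subtype_apply,
    exteriorPower.ιMulti_apply_coe, LinearMap.mul_apply', ExteriorAlgebra.ιMulti_mul_ιMulti, volume,
    ExteriorAlgebra.liftAlternating_apply_ιMulti, Function.update_self]

variable [FiniteDimensional ℂ 𝔤] [IsKilling ℂ 𝔤]

/-- The Hodge star operator `⋀ⁿ 𝔤 → ⋀ᵐ 𝔤` of the Killing form, for `n + m = dim 𝔤`. -/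
def hodgeStar (e : Basis (Fin (n + m)) ℂ 𝔤) : ⋀[ℂ]^n 𝔤 →ₗ[ℂ] ⋀[ℂ]^m 𝔤 :=
  (killingPairingEquiv m).symm.toLinearMap ∘ₗ wedgePairing e

lemma altForm_hodgeStar (e : Basis (Fin (n + m)) ℂ 𝔤) (ω : ⋀[ℂ]^n 𝔤) (v : Fin m → 𝔤) :
    altForm m (hodgeStar e ω) v = wedgePairing e ω (exteriorPower.ιMulti ℂ m v) := by
  rw [altForm_apply]
  change killingPairingEquiv m _ _ = _
  rw [hodgeStar, LinearMap.comp_apply, LinearEquiv.coe_coe, LinearEquiv.apply_symm_apply]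

lemma hodgeStar_mem (e : Basis (Fin (n + m)) ℂ 𝔤) (W : Gr n 𝔤) (U : Gr m 𝔤)
    (hU : (killingForm ℂ 𝔤).orthogonal U.1 = W.1) {ω : ⋀[ℂ]^n 𝔤}
    (hω : ω ∈ (pluckerPoint W).submodule) :
    hodgeStar e ω ∈ (pluckerPoint U).submodule := by
  rw [mem_submodule_pluckerPoint_iff, hU, le_radical_iff]
  intro v i hv
  rw [altForm_hodgeStar]
  rw [pluckerPoint, Projectivization.submodule_mk'', range_map_subtype_eq_span] at hω
  induction hω using Submodule.span_induction with
  | mem x hx =>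
    obtain ⟨w, rfl⟩ := hx
    rw [wedgePairing_ιMulti]
    refine AlternatingMap.map_linearDependent _ _ fun hli => ?_
    -- The entries `w` together with `v i` are `n + 1` vectors of the `n`-dimensional `W`, so the
    -- determinant has dependent arguments.
    let j : Option (Fin n) → Fin (n + m) := fun o => o.elim (Fin.natAdd n i) (Fin.castAdd m)
    have hj : Function.Injective j := by
      rintro (_ | a) (_ | b) hab
      · rfl
      · simp only [j, Option.elim, Fin.ext_iff, Fin.val_natAdd, Fin.val_castAdd] at hab
        omega
      · simp only [j, Option.elim, Fin.ext_iff, Fin.val_natAdd, Fin.val_castAdd] at hab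
        omega
      · simp only [j, Option.elim, Fin.ext_iff, Fin.val_castAdd] at hab
        exact congrArg some (Fin.ext hab)
    let y : Option (Fin n) → W.1 := fun o => o.elim ⟨v i, hv⟩ w
    have hy : LinearIndependent ℂ y := by
      refine LinearIndependent.of_comp W.1.subtype ?_
      have hyj : W.1.subtype ∘ y = Fin.append (fun i => (w i : 𝔤)) v ∘ j := by
        ext o
        cases o <;> simp [y, j]
      rw [hyj]
      exact hli.comp j hj
    have := hy.fintype_card_le_finrank
    rw [Fintype.card_option, Fintype.card_fin, W.2] at this
    omega
  | zero => simp
  | add x y _ _ hx hy => simp [hx, hy]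
  | smul c x _ hx => simp [hx]

/-- A basis of `W` completed by one of a complement has nonzero volume. -/
lemma exists_hodgeStar_ne_zero (e : Basis (Fin (n + m)) ℂ 𝔤) (W : Gr n 𝔤) :
    ∃ ω ∈ (pluckerPoint W).submodule, hodgeStar e ω ≠ 0 := by
  obtain ⟨W', hW'⟩ := W.1.exists_isCompl
  have hfin : finrank ℂ W' = m := by
    have h1 := Submodule.finrank_add_eq_of_isCompl hW'
    have h2 := finrank_eq_card_basis e
    rw [Fintype.card_fin] at h2
    have := W.2
    omega
  let b : Basis (Fin n) ℂ W.1 := (finBasis ℂ W.1).reindex (finCongr W.2)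
  let b' : Basis (Fin m) ℂ W' := (finBasis ℂ W').reindex (finCongr hfin)
  refine ⟨exteriorPower.ιMulti ℂ n fun i => (b i : 𝔤), ?_, fun h0 => ?_⟩
  · rw [pluckerPoint, Projectivization.submodule_mk'', range_map_subtype_eq_span]
    exact Submodule.subset_span ⟨b, rfl⟩
  · have h1 : e.det (Fin.append (fun i => (b i : 𝔤)) fun i => (b' i : 𝔤)) = 0 := by
      rw [← wedgePairing_ιMulti, ← altForm_hodgeStar, h0]
      simp
    let B := (b.prod b').map (Submodule.prodEquivOfIsCompl _ _ hW')
    let B' := B.reindex finSumFinEquiv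
    have hB : (B' : Fin (n + m) → 𝔤) = Fin.append (fun i => (b i : 𝔤)) fun i => (b' i : 𝔤) := by
      ext i
      refine Fin.addCases (fun i => ?_) (fun i => ?_) i <;> simp [B', B]
    rw [← hB] at h1
    exact (e.isUnit_det B').ne_zero h1

/-- Decomposable elements suffice. The line of `U = ⟨u⟩` is hit because the star maps the line of
`U^⊥` into it and is not zero there. -/
lemma hodgeStar_surjective (e : Basis (Fin (n + m)) ℂ 𝔤) :
    Function.Surjective (hodgeStar e) := by
  rw [← LinearMap.range_eq_top, eq_top_iff, ← exteriorPower.ιMulti_span, Submodule.span_le]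
  rintro _ ⟨u, rfl⟩
  by_cases hu : LinearIndependent ℂ u
  · have hfin : finrank ℂ (Submodule.span ℂ (Set.range u)) = m := by
      rw [finrank_span_eq_card hu, Fintype.card_fin]
    have h1 := finrank_add_finrank_orthogonal (Submodule.span ℂ (Set.range u))
    have h2 := finrank_eq_card_basis e
    rw [Fintype.card_fin] at h2
    let U : Gr m 𝔤 := ⟨_, hfin⟩
    let W : Gr n 𝔤 := ⟨(killingForm ℂ 𝔤).orthogonal U.1, by simp only [U]; omega⟩
    obtain ⟨ω, hω, hne⟩ := exists_hodgeStar_ne_zero e W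
    have hmem := hodgeStar_mem e W U rfl hω
    have hu' : exteriorPower.ιMulti ℂ m u ∈ (pluckerPoint U).submodule := by
      rw [pluckerPoint, Projectivization.submodule_mk'', range_map_subtype_eq_span]
      exact Submodule.subset_span
        ⟨fun i => ⟨u i, Submodule.subset_span (Set.mem_range_self i)⟩, rfl⟩
    obtain ⟨c, hc⟩ := (finrank_eq_one_iff_of_nonzero' (⟨_, hmem⟩ : (pluckerPoint U).submodule)
      (fun h => hne (congrArg Subtype.val h))).1 (Projectivization.finrank_submodule _) ⟨_, hu'⟩
    exact ⟨c • ω, by rw [map_smul]; exact congrArg Subtype.val hc⟩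
  · rw [AlternatingMap.map_linearDependent _ _ hu]
    exact Submodule.zero_mem _

lemma hodgeStar_injective (e : Basis (Fin (n + m)) ℂ 𝔤) : Function.Injective (hodgeStar e) := by
  refine (LinearMap.injective_iff_surjective_of_finrank_eq_finrank ?_).2 (hodgeStar_surjective e)
  rw [exteriorPower.finrank_eq, exteriorPower.finrank_eq, finrank_eq_card_basis e, Fintype.card_fin]
  exact Nat.choose_symm_add

lemma map_hodgeStar_pluckerPoint (e : Basis (Fin (n + m)) ℂ 𝔤) (W : Gr n 𝔤) (U : Gr m 𝔤)
    (hU : (killingForm ℂ 𝔤).orthogonal W.1 = U.1) :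
    Projectivization.map (hodgeStar e) (hodgeStar_injective e) (pluckerPoint W) =
      pluckerPoint U := by
  have hne : hodgeStar e (pluckerPoint W).rep ≠ 0 := fun h0 =>
    (pluckerPoint W).rep_nonzero (hodgeStar_injective e (h0.trans (map_zero _).symm))
  refine eq_of_mem_submodule hne ?_
    (hodgeStar_mem e W U (by rw [← hU, orthogonal_orthogonal]) (rep_mem_submodule _))
  have hmap : Projectivization.map (hodgeStar e) (hodgeStar_injective e) (pluckerPoint W) =
      Projectivization.mk ℂ _ hne := by
    conv_lhs => rw [← (pluckerPoint W).mk_rep, Projectivization.map_mk]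
  rw [hmap]
  exact Submodule.mem_span_singleton_self _

end Star

/-! ### Symmetry and invariance of the form `w` -/

section Trilinear

variable {𝔤 : Type*} [LieRing 𝔤] [LieAlgebra ℂ 𝔤]

lemma trilin_sum {ι : Type*} [Fintype ι] (e : ι → 𝔤) (a b c : ι → ℂ) :
    trilin (∑ i, a i • e i) (∑ i, b i • e i) (∑ i, c i • e i) =
      ∑ i, ∑ j, ∑ l, trilin (e i) (e j) (e l) * (a i * b j * c l) := by
  simp only [trilin, sum_lie, lie_sum, map_sum, LinearMap.sum_apply, smul_lie,
    lie_smul, map_smul, LinearMap.smul_apply, smul_eq_mul, Finset.mul_sum]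
  rw [Finset.sum_congr rfl fun i _ => Finset.sum_comm, Finset.sum_comm,
    Finset.sum_congr rfl fun i _ => Finset.sum_comm]
  exact Finset.sum_congr rfl fun i _ => Finset.sum_congr rfl fun j _ =>
    Finset.sum_congr rfl fun l _ => by ring

lemma trilin_rotate (x y z : 𝔤) : trilin x y z = trilin y z x := by
  rw [trilin, trilin, LieModule.traceForm_apply_lie_apply, LieModule.traceForm_comm]

lemma trilin_swap (x y z : 𝔤) : trilin y x z = -trilin x y z := by
  rw [trilin, trilin, ← lie_skew, map_neg, LinearMap.neg_apply]

lemma trilin_map (e : 𝔤 ≃ₗ⁅ℂ⁆ 𝔤) (x y z : 𝔤) : trilin (e x) (e y) (e z) = trilin x y z := by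
  rw [trilin, ← LieEquiv.map_lie, killingForm_of_equiv_apply, trilin]

end Trilinear

/-! ### The equations `δ(η)` and the linear space `N` -/

section Equations

variable {𝔤 : Type*} [LieRing 𝔤] [LieAlgebra ℂ 𝔤]

lemma toSection_apply {n : ℕ} (u : ⋀[ℂ]^n 𝔤) (Λ : Gr n 𝔤) (v : Fin n → Λ.1) :
    toSection n u Λ v = killingPairing n u (exteriorPower.ιMulti ℂ n fun i => (v i : 𝔤)) := rfl

lemma eval_frameCoord {n m : ℕ} (e : Basis (Fin n ⊕ Fin m) ℂ 𝔤) (X : Fin n × Fin m → ℂ)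
    (i : Fin n) : ∑ b, MvPolynomial.eval X (frameCoord i b) • e b = frame e X i := by
  rw [Fintype.sum_sum_type, frame]
  congr 1
  · rw [Finset.sum_eq_single i]
    · simp [frameCoord]
    · intro j _ hj
      simp [frameCoord, hj.symm]
    · simp
  · simp [frameCoord]

lemma eval_nullEquation {n m : ℕ} (e : Basis (Fin n ⊕ Fin m) ℂ 𝔤) (X : Fin n × Fin m → ℂ)
    (i₁ i₂ i₃ : Fin n) : MvPolynomial.eval X (nullEquation e i₁ i₂ i₃) =
      trilin (frame e X i₁) (frame e X i₂) (frame e X i₃) := by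
  simp only [← eval_frameCoord, trilin_sum, nullEquation, map_sum, map_mul, MvPolynomial.eval_C]

variable [IsKilling ℂ 𝔤]

lemma sum_killingForm_dualBasis_smul {ι : Type*} [Fintype ι] [DecidableEq ι] (e : Basis ι ℂ 𝔤)
    (x : 𝔤) :
    ∑ i, killingForm ℂ 𝔤 ((killingForm ℂ 𝔤).dualBasis
      (IsKilling.killingForm_nondegenerate ℂ 𝔤) e i) x • e i = x := by
  have h : ∀ i, killingForm ℂ 𝔤 ((killingForm ℂ 𝔤).dualBasis
      (IsKilling.killingForm_nondegenerate ℂ 𝔤) e i) = e.coord i := by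
    intro i
    refine e.ext fun j => ?_
    rw [LinearMap.BilinForm.apply_dualBasis_left, Basis.coord_apply, Basis.repr_self,
      Finsupp.single_apply]
  simp only [h, Basis.coord_apply]
  exact e.sum_repr x

lemma trilin_eq_sum {ι : Type*} [Fintype ι] [DecidableEq ι] (e : Basis ι ℂ 𝔤) (x y z : 𝔤) :
    let e' := (killingForm ℂ 𝔤).dualBasis (IsKilling.killingForm_nondegenerate ℂ 𝔤) e
    trilin x y z = ∑ i, ∑ j, ∑ l, trilin (e i) (e j) (e l) *
      (killingForm ℂ 𝔤 (e' i) x * killingForm ℂ 𝔤 (e' j) y * killingForm ℂ 𝔤 (e' l) z) := by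
  intro e'
  rw [← trilin_sum]
  simp only [e', sum_killingForm_dualBasis_smul]

variable [FiniteDimensional ℂ 𝔤]

/-- The value of `w` as an alternating form. -/
lemma killingPairing_wElt (x y z : 𝔤) :
    killingPairing 3 wElt (exteriorPower.ιMulti ℂ 3 ![x, y, z]) = trilin x y z := by
  -- The six signed terms, all equal, match the six terms of the `3 × 3` determinants that come from
  -- `wElt`.
  have h6 : trilin x y z = (1 / 6 : ℂ) * (trilin x y z - trilin x z y - trilin y x z +
      trilin y z x + trilin z x y - trilin z y x) := by
    rw [trilin_swap x y z, trilin_swap y z x, trilin_swap z x y, ← trilin_rotate y z x,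
      ← trilin_rotate x y z]
    ring
  rw [h6]
  let e := finBasis ℂ 𝔤
  rw [trilin_eq_sum e x y z, trilin_eq_sum e x z y, trilin_eq_sum e y x z, trilin_eq_sum e y z x,
    trilin_eq_sum e z x y, trilin_eq_sum e z y x]
  simp only [wElt, map_smul, map_sum, LinearMap.smul_apply, LinearMap.sum_apply, smul_eq_mul,
    killingPairing_ιMulti_ιMulti, Matrix.det_fin_three, Matrix.of_apply,
    ← Finset.sum_sub_distrib, ← Finset.sum_add_distrib]
  congr 1
  refine Finset.sum_congr rfl fun i _ => Finset.sum_congr rfl fun j _ =>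
    Finset.sum_congr rfl fun l _ => ?_
  simp only [Matrix.cons_val_zero, Matrix.cons_val_one, Matrix.cons_val, e]
  ring

lemma delta_ιMulti {k : ℕ} (a : Fin k → 𝔤) :
    let e := finBasis ℂ 𝔤
    let e' := (killingForm ℂ 𝔤).dualBasis (IsKilling.killingForm_nondegenerate ℂ 𝔤) e
    delta k (exteriorPower.ιMulti ℂ k a) = (1 / 6 : ℂ) • ∑ i, ∑ j, ∑ l,
      trilin (e i) (e j) (e l) •
        exteriorPower.ιMulti ℂ (k + 3) (Fin.append a ![e' i, e' j, e' l]) := by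
  apply Subtype.ext
  simp only [delta, wElt, LinearMap.coe_mk, AddHom.coe_mk, Submodule.coe_smul, Submodule.coe_sum,
    exteriorPower.ιMulti_apply_coe, mul_smul_comm, Finset.mul_sum,
    ExteriorAlgebra.ιMulti_mul_ιMulti]

/-- The value of `δ(a₁ ∧ ⋯ ∧ aₖ)` as an alternating form. -/
lemma killingPairing_delta_ιMulti {k : ℕ} (a : Fin k → 𝔤) (v : Fin (k + 3) → 𝔤) :
    killingPairing (k + 3) (delta k (exteriorPower.ιMulti ℂ k a))
      (exteriorPower.ιMulti ℂ (k + 3) v) =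
    (1 / 6 : ℂ) * ∑ π : Equiv.Perm (Fin (k + 3)), (Equiv.Perm.sign π : ℂ) *
      ((∏ i, killingForm ℂ 𝔤 (a i) (v (π (Fin.castAdd 3 i)))) *
        trilin (v (π (Fin.natAdd k 0))) (v (π (Fin.natAdd k 1))) (v (π (Fin.natAdd k 2)))) := by
  rw [delta_ιMulti]
  simp only [map_smul, map_sum, LinearMap.smul_apply, LinearMap.sum_apply, smul_eq_mul,
    killingPairing_ιMulti_ιMulti, Matrix.det_apply, Matrix.of_apply, Fin.prod_univ_add,
    Fin.append_left, Fin.append_right, Fin.prod_univ_three, Finset.mul_sum]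
  simp only [Matrix.cons_val_zero, Matrix.cons_val_one, Matrix.cons_val]
  -- With the sum over permutations outermost, the sum over basis triples is the expansion of one
  -- value of `w`.
  rw [Finset.sum_congr rfl fun i _ => Finset.sum_congr rfl fun j _ => Finset.sum_comm]
  rw [Finset.sum_congr rfl fun i _ => Finset.sum_comm, Finset.sum_comm]
  refine Finset.sum_congr rfl fun π _ => ?_
  rw [trilin_eq_sum (finBasis ℂ 𝔤) (v (π (Fin.natAdd k 0)))]
  simp only [Finset.mul_sum]
  refine Finset.sum_congr rfl fun i _ => Finset.sum_congr rfl fun j _ =>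
    Finset.sum_congr rfl fun l _ => ?_
  rw [Units.smul_def, zsmul_eq_mul]
  ring

/-- An independent tuple is a basis of a point of the grassmannian; on dependent tuples alternating
forms vanish anyway. -/
lemma toSection_injective (n : ℕ) : Function.Injective (toSection (𝔤 := 𝔤) n) := by
  rw [← LinearMap.ker_eq_bot, LinearMap.ker_eq_bot']
  intro u hu
  refine (altForm n).injective ?_
  rw [map_zero]
  ext v
  by_cases hv : LinearIndependent ℂ v
  · have h := DFunLike.congr_fun
      (congrFun hu ⟨_, (finrank_span_eq_card hv).trans (Fintype.card_fin n)⟩)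
      fun i => ⟨v i, Submodule.subset_span (Set.mem_range_self i)⟩
    rw [toSection_apply] at h
    rw [altForm_apply]
    exact h
  · exact (altForm n u).map_linearDependent v hv

/-- By linearity `η` may be decomposable. The permutation formula on a frame, read as a polynomial
in the chart, has a factor `nullEquation` in each term. -/
lemma map_toSection_range_delta_le (k : ℕ) :
    (LinearMap.range (delta (𝔤 := 𝔤) k)).map (toSection (k + 3)) ≤ sectionsIY (k + 3) := by
  rw [LinearMap.range_eq_map, ← exteriorPower.ιMulti_span, Submodule.map_span, Submodule.map_span,
    Submodule.span_le]
  rintro _ ⟨_, ⟨_, ⟨a, rfl⟩, rfl⟩, rfl⟩ m e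
  refine ⟨MvPolynomial.C (1 / 6) * ∑ π : Equiv.Perm (Fin (k + 3)),
    MvPolynomial.C (Equiv.Perm.sign π : ℂ) *
      ((∏ i, ∑ b, frameCoord (π (Fin.castAdd 3 i)) b *
        MvPolynomial.C (killingForm ℂ 𝔤 (a i) (e b))) *
        nullEquation e (π (Fin.natAdd k 0)) (π (Fin.natAdd k 1)) (π (Fin.natAdd k 2))), ?_, ?_⟩
  · exact Ideal.mul_mem_left _ _ (Ideal.sum_mem _ fun π _ => Ideal.mul_mem_left _ _
      (Ideal.mul_mem_left _ _ (Ideal.subset_span ⟨_, _, _, rfl⟩)))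
  · intro X Λ v hv
    rw [toSection_apply, killingPairing_delta_ιMulti]
    simp only [hv, map_mul, map_sum, map_prod, MvPolynomial.eval_C, eval_nullEquation]
    simp only [← eval_frameCoord e X, map_sum, map_smul, smul_eq_mul]

lemma mem_equationSpace_iff {k : ℕ} (u : ⋀[ℂ]^(k + 3) 𝔤) :
    u ∈ equationSpace k ↔ ∀ η, killingPairing (k + 3) (delta k η) u = 0 := by
  simp [equationSpace, Submodule.mem_iInf]

/-- The Plücker points of the nullspaces of `w` are in the linear subspace `N`. -/
lemma pluckerPoint_submodule_le_equationSpace {k : ℕ} (U : Gr (k + 3) 𝔤)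
    (hU : ∀ x ∈ U.1, ∀ y ∈ U.1, ∀ z ∈ U.1, trilin x y z = 0) :
    (pluckerPoint U).submodule ≤ equationSpace k := by
  rw [pluckerPoint, Projectivization.submodule_mk'', range_map_subtype_eq_span, Submodule.span_le]
  rintro _ ⟨v, rfl⟩
  rw [SetLike.mem_coe, mem_equationSpace_iff]
  intro η
  have hη : η ∈ Submodule.span ℂ (Set.range (exteriorPower.ιMulti ℂ k)) := by
    rw [exteriorPower.ιMulti_span]
    exact Submodule.mem_top
  induction hη using Submodule.span_induction with
  | mem x hx =>
    obtain ⟨a, rfl⟩ := hx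
    rw [killingPairing_delta_ιMulti]
    simp [hU _ (v _).2 _ (v _).2 _ (v _).2]
  | zero => simp
  | add x y _ _ hx hy => simp [hx, hy]
  | smul c x _ hx => simp [hx]

/-- If `w = 0`, nondegeneracy of `κ` kills the bracket, which in turn kills `κ`. -/
lemma wElt_ne_zero [Nontrivial 𝔤] : wElt (𝔤 := 𝔤) ≠ 0 := by
  intro h0
  have h : ∀ x y z : 𝔤, trilin x y z = 0 := fun x y z => by
    rw [← killingPairing_wElt, h0]
    simp
  have hab : ∀ x y : 𝔤, ⁅x, y⁆ = 0 := fun x y =>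
    LinearMap.ker_eq_bot'.1 (IsKilling.ker_killingForm_eq_bot ℂ 𝔤) _ (LinearMap.ext (h x y))
  obtain ⟨x, hx⟩ := exists_ne (0 : 𝔤)
  refine hx (LinearMap.ker_eq_bot'.1 (IsKilling.ker_killingForm_eq_bot ℂ 𝔤) x ?_)
  have hadx : ad ℂ 𝔤 x = 0 := LinearMap.ext (hab x)
  ext y
  simp [killingForm_apply_apply, hadx]

/-- If all `η ∧ w` vanish in degree `k`, then so do all `ζ ∧ w` in top degree, on splitting off the
last `k` factors of `ζ`. The wedge pairing being perfect, `w = 0`. -/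
lemma exists_delta_ne_zero [Nontrivial 𝔤] {k : ℕ} (hk : k + 3 ≤ finrank ℂ 𝔤) :
    ∃ η, delta (𝔤 := 𝔤) k η ≠ 0 := by
  by_contra! h
  obtain ⟨r, hr⟩ := Nat.exists_eq_add_of_le hk
  have hr' : finrank ℂ 𝔤 = (r + k) + 3 := by omega
  let e : Basis (Fin ((r + k) + 3)) ℂ 𝔤 := (finBasis ℂ 𝔤).reindex (finCongr hr')
  have hzero : ∀ ζ, wedgePairing e ζ wElt = 0 := by
    intro ζ
    have hζ : ζ ∈ Submodule.span ℂ (Set.range (exteriorPower.ιMulti ℂ (r + k))) := by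
      rw [exteriorPower.ιMulti_span]
      exact Submodule.mem_top
    induction hζ using Submodule.span_induction with
    | mem x hx =>
      obtain ⟨v, rfl⟩ := hx
      have hv := Fin.append_castAdd_natAdd (f := v)
      have h1 := congrArg Subtype.val
        (h (exteriorPower.ιMulti ℂ k fun i => v (Fin.natAdd r i)))
      simp only [delta, LinearMap.coe_mk, AddHom.coe_mk, exteriorPower.ιMulti_apply_coe,
        ZeroMemClass.coe_zero] at h1
      simp only [wedgePairing, LinearMap.compl₁₂_apply, LinearMap.compr₂_apply,
        Submodule.subtype_apply, exteriorPower.ιMulti_apply_coe, LinearMap.mul_apply']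
      rw [← hv, ← ExteriorAlgebra.ιMulti_mul_ιMulti, mul_assoc, h1, mul_zero, map_zero]
    | zero => simp
    | add x y _ _ hx hy => simp [hx, hy]
    | smul c x _ hx => simp [hx]
  refine wElt_ne_zero (𝔤 := 𝔤) ((killingPairing_injective 3) (LinearMap.ext fun η => ?_))
  rw [map_zero, LinearMap.zero_apply]
  obtain ⟨φ, hφ⟩ := (killingPairingEquiv 3).surjective ((killingPairing (𝔤 := 𝔤) 3).flip η)
  obtain ⟨ζ, hζ⟩ := hodgeStar_surjective e φ
  have h1 : wedgePairing e ζ = (killingPairing 3).flip η := by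
    rw [← hφ, ← hζ, hodgeStar, LinearMap.comp_apply, LinearEquiv.coe_coe,
      LinearEquiv.apply_symm_apply]
  rw [← LinearMap.flip_apply, ← h1, hzero]

lemma finrank_equationSpace_lt [Nontrivial 𝔤] {k : ℕ} (hk : k + 3 ≤ finrank ℂ 𝔤) :
    finrank ℂ (equationSpace (𝔤 := 𝔤) k) < finrank ℂ (⋀[ℂ]^(k + 3) 𝔤) := by
  refine Submodule.finrank_lt fun h => ?_
  obtain ⟨η, hη⟩ := exists_delta_ne_zero hk
  refine hη (killingPairing_injective _ (LinearMap.ext fun u => ?_))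
  rw [map_zero]
  exact (mem_equationSpace_iff u).1 (h ▸ Submodule.mem_top) η

end Equations

/-! ### Exponentials of inner derivations -/

section Exponential

open NormedSpace Filter Topology

variable {E : Type*} [NormedAddCommGroup E] [NormedSpace ℂ E] [FiniteDimensional ℂ E]

/-- For a bracket `A` on `E` that satisfies the Jacobi identity, `exp (A m)` is an automorphism. -/
lemma exp_neg_mul_mul_exp (A : E →L[ℂ] E →L[ℂ] E)
    (hA : ∀ m y, A (A m y) = A m * A y - A y * A m) (m y : E) :
    exp (-A m) * A (exp (A m) y) * exp (A m) = A y := by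
  have := FiniteDimensional.complete ℂ E
  -- By the Jacobi identity this curve has zero derivative; its values at `1` and `0` are the two
  -- sides.
  let c : ℂ → E →L[ℂ] E := fun t => exp (t • -A m) * A (exp (t • A m) y) * exp (t • A m)
  have hc : ∀ t, HasDerivAt c 0 t := by
    intro t
    have hQ := hasDerivAt_exp_smul_const' (𝕂 := ℂ) (A m) t
    have hP := hasDerivAt_exp_smul_const (𝕂 := ℂ) (-A m) t
    have hy := A.hasFDerivAt.comp_hasDerivAt t (hQ.clm_apply (hasDerivAt_const t y))
    refine ((hP.mul hy).mul hQ).congr_deriv ?_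
    have hmul : (A m * exp (t • A m)) y = A m (exp (t • A m) y) := rfl
    simp only [map_zero, add_zero, hmul, hA, Pi.mul_apply, Function.comp_apply]
    noncomm_ring
  have h01 := is_const_of_deriv_eq_zero (fun t => (hc t).differentiableAt)
    (fun t => (hc t).deriv) 1 0
  simpa [c] using h01

lemma charpoly_exp_apply (A : E →L[ℂ] E →L[ℂ] E)
    (hA : ∀ m y, A (A m y) = A m * A y - A y * A m) (m y : E) :
    (A (exp (A m) y) : E →ₗ[ℂ] E).charpoly = (A y : E →ₗ[ℂ] E).charpoly := by
  have := FiniteDimensional.complete ℂ E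
  let : NormedAlgebra ℚ (E →L[ℂ] E) := NormedAlgebra.restrictScalars ℚ ℂ _
  have h1 : exp (A m) * exp (-A m) = 1 := by
    rw [← exp_add_of_commute ((Commute.refl (A m)).neg_right), add_neg_cancel, exp_zero]
  have h2 : exp (-A m) * exp (A m) = 1 := by
    rw [← exp_add_of_commute ((Commute.refl (A m)).neg_left), neg_add_cancel, exp_zero]
  let Q : E ≃ₗ[ℂ] E := LinearEquiv.ofLinearMap (exp (-A m) : E →L[ℂ] E) (exp (A m) : E →L[ℂ] E)
    (by ext v; exact DFunLike.congr_fun h2 v) (by ext v; exact DFunLike.congr_fun h1 v)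
  rw [← LinearEquiv.charpoly_conj Q]
  congr 1
  ext v
  exact DFunLike.congr_fun (exp_neg_mul_mul_exp A hA m y) v

/-- The hypothesis `h` is surjectivity of the derivative of `(m, y) ↦ exp (A m) y` at `(0, x)`, so
this map is open there. Applied to a Cartan subalgebra `S`, it conjugates all elements near `x` into
`S`. -/
lemma eventually_exists_exp_apply_eq (A : E →L[ℂ] E →L[ℂ] E) (S : Submodule ℂ E) (x : S)
    (h : ∀ v, ∃ m, ∃ y : S, A m x + y = v) :
    ∀ᶠ z in 𝓝 (x : E), ∃ m, ∃ y : S, exp (A m) y = z := by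
  have := FiniteDimensional.complete ℂ E
  have := FiniteDimensional.complete ℂ S
  let F : E × S → E := fun p => exp (A p.1) p.2
  have hexp : HasStrictFDerivAt (fun p : E × S => exp (A p.1))
      (A ∘L ContinuousLinearMap.fst ℂ E S) (0, x) := by
    have h0 : HasStrictFDerivAt (exp : (E →L[ℂ] E) → (E →L[ℂ] E)) (1 : (E →L[ℂ] E) →L[ℂ] _)
        ((A ∘L ContinuousLinearMap.fst ℂ E S) (0, x)) := by
      simpa using hasStrictFDerivAt_exp_zero (𝕂 := ℂ) (𝔸 := E →L[ℂ] E)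
    exact h0.comp (0, x) (A ∘L ContinuousLinearMap.fst ℂ E S).hasStrictFDerivAt
  have hF := hexp.clm_apply (S.subtypeL ∘L ContinuousLinearMap.snd ℂ E S).hasStrictFDerivAt
  have hsurj := hF.map_nhds_eq_of_surj (by
    rw [LinearMap.range_eq_top]
    intro v
    obtain ⟨m, y, rfl⟩ := h v
    exact ⟨(m, y), by simp [add_comm]⟩)
  have hx : (exp (A (0 : E))) (x : E) = x := by simp
  have hr : Set.range F ∈ map F (𝓝 (0, x)) := range_mem_map
  have hr' : Set.range F ∈ 𝓝 (x : E) := by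
    rw [← hx]
    exact hsurj ▸ hr
  filter_upwards [hr'] with z hz
  obtain ⟨⟨m, y⟩, rfl⟩ := hz
  exact ⟨m, y, rfl⟩

end Exponential

/-! ### Cartan subalgebras have dimension equal to the rank -/

section Cartan

open LieSubalgebra

lemma exists_eval_ne_zero_of_mem_nhds {n : ℕ} {p : MvPolynomial (Fin n) ℂ} (hp : p ≠ 0)
    {x : Fin n → ℂ} {s : Set (Fin n → ℂ)} (hs : s ∈ nhds x) :
    ∃ z ∈ s, MvPolynomial.eval z p ≠ 0 := by
  by_contra! h
  obtain ⟨r, hr, hrs⟩ := Metric.mem_nhds_iff.1 hs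
  rw [ball_pi x hr] at hrs
  refine hp (MvPolynomial.funext_set (fun i => Metric.ball (x i) r)
    (fun i => infinite_of_mem_nhds (x i) (Metric.ball_mem_nhds _ hr)) fun z hz => ?_)
  rw [h z (hrs hz), map_zero]

variable {𝔤 : Type*} [LieRing 𝔤] [LieAlgebra ℂ 𝔤]

/-- The Lie bracket in linear coordinates. -/
def coordinateBracket {n : ℕ} (φ : 𝔤 ≃ₗ[ℂ] (Fin n → ℂ)) :
    (Fin n → ℂ) →L[ℂ] (Fin n → ℂ) →L[ℂ] (Fin n → ℂ) :=
  LinearMap.toContinuousBilinearMap (((LinearMap.mk₂ ℂ (fun x y : 𝔤 => ⁅x, y⁆) add_lie smul_lie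
    lie_add (fun c x y => lie_smul c x y)).compl₁₂ φ.symm.toLinearMap φ.symm.toLinearMap).compr₂
    φ.toLinearMap)

lemma coordinateBracket_apply {n : ℕ} (φ : 𝔤 ≃ₗ[ℂ] (Fin n → ℂ)) (m y : Fin n → ℂ) :
    coordinateBracket φ m y = φ ⁅φ.symm m, φ.symm y⁆ := rfl

variable [FiniteDimensional ℂ 𝔤]

lemma rank_pos [Nontrivial 𝔤] : 0 < rank ℂ 𝔤 := by
  rw [Nat.pos_iff_ne_zero]
  intro h
  obtain ⟨x, hx⟩ := exists_isRegular ℂ 𝔤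
  rw [isRegular_iff_finrank_engel_eq_rank, h] at hx
  replace hx := Submodule.finrank_eq_zero.1 hx
  have hx0 : x = 0 := by
    have : x ∈ (engel ℂ x).toSubmodule := self_mem_engel ℂ x
    rwa [hx, Submodule.mem_bot] at this
  rw [hx0, engel_zero] at hx
  exact top_ne_bot hx

variable [IsKilling ℂ 𝔤]

lemma lie_eq_zero_of_mem_cartan (H : LieSubalgebra ℂ 𝔤) [H.IsCartanSubalgebra] {x y : 𝔤}
    (hx : x ∈ H) (hy : y ∈ H) : ⁅x, y⁆ = 0 :=
  congrArg Subtype.val (LieModule.IsTrivial.trivial (⟨x, hx⟩ : H) (⟨y, hy⟩ : H))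

lemma cartan_le_engel (H : LieSubalgebra ℂ 𝔤) [H.IsCartanSubalgebra] {x : 𝔤} (hx : x ∈ H) :
    H ≤ engel ℂ x := fun y hy => by
  rw [mem_engel_iff]
  exact ⟨1, by simpa using lie_eq_zero_of_mem_cartan H hx hy⟩

/-- Over an infinite field, a minimal Engel subalgebra among those of elements of `H` lies in all
the others. Hence `H` acts nilpotently on it, and it lies in the zero root subalgebra, which is `H`.
-/
lemma exists_engel_eq_cartan (H : LieSubalgebra ℂ 𝔤) [H.IsCartanSubalgebra] :
    ∃ x ∈ H, engel ℂ x = H := by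
  obtain ⟨x, hx⟩ := exists_minimalFor_of_wellFoundedLT (fun _ : H => True)
    (fun y : H => finrank ℂ (engel ℂ (y : 𝔤))) ⟨0, trivial⟩
  refine ⟨x, x.2, le_antisymm ?_ (cartan_le_engel H x.2)⟩
  let E : {engel ℂ y | y ∈ H} := ⟨engel ℂ (x : 𝔤), x, x.2, rfl⟩
  have hmin : IsMin E := by
    rintro ⟨_, y, hy, rfl⟩ hle
    have hle' : engel ℂ y ≤ engel ℂ (x : 𝔤) := hle
    have h1 := hx.2 (j := ⟨y, hy⟩) trivial (Submodule.finrank_mono hle')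
    have h2 := Submodule.eq_of_le_of_finrank_le
      (show (engel ℂ y).toSubmodule ≤ (engel ℂ (x : 𝔤)).toSubmodule from hle') h1
    exact h2.ge
  have hbot := engel_isBot_of_isMin (K := ℂ)
    (Cardinal.natCast_le_aleph0.trans (Cardinal.aleph0_le_mk ℂ)) H E
    (cartan_le_engel H x.2) hmin
  intro v hv
  rw [← zeroRootSubalgebra_eq_of_is_cartan ℂ 𝔤 H, mem_zeroRootSubalgebra]
  intro y
  have hy : engel ℂ (x : 𝔤) ≤ engel ℂ (y : 𝔤) := hbot ⟨_, y, y.2, rfl⟩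
  obtain ⟨n, hn⟩ := (mem_engel_iff ℂ _ _).1 (hy hv)
  exact ⟨n, hn⟩

/-- If `[x, u]` is killed by `ad x`, then `u` is in the Engel subalgebra `H`, which is abelian, so
`[x, u] = 0`. Thus kernel and image of `ad x` are complementary, and the kernel lies in `H`. -/
lemma exists_lie_add_eq {H : LieSubalgebra ℂ 𝔤} [H.IsCartanSubalgebra] {x : 𝔤} (hxH : x ∈ H)
    (hx : engel ℂ x = H) (v : 𝔤) : ∃ m : 𝔤, ∃ y ∈ H, ⁅m, x⁆ + y = v := by
  have hss := (IsKilling.isSemisimple_ad_of_mem_isCartanSubalgebra (H := H) hxH)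
  have hdisj : Disjoint (LinearMap.ker (ad ℂ 𝔤 x)) (LinearMap.range (ad ℂ 𝔤 x)) := by
    rw [Submodule.disjoint_def]
    rintro _ hk ⟨u, rfl⟩
    have hu : u ∈ engel ℂ x := (mem_engel_iff ℂ _ _).2 ⟨2, by rw [pow_two]; exact hk⟩
    rw [hx] at hu
    simpa using lie_eq_zero_of_mem_cartan H hxH hu
  have htop : LinearMap.ker (ad ℂ 𝔤 x) ⊔ LinearMap.range (ad ℂ 𝔤 x) = ⊤ := by
    refine Submodule.eq_top_of_disjoint _ _ ?_ hdisj
    rw [add_comm, LinearMap.finrank_range_add_finrank_ker]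
  obtain ⟨y, hy, _, ⟨m, rfl⟩, rfl⟩ := Submodule.mem_sup.1
    (htop ▸ Submodule.mem_top : v ∈ LinearMap.ker (ad ℂ 𝔤 x) ⊔ LinearMap.range (ad ℂ 𝔤 x))
  refine ⟨-m, y, ?_, ?_⟩
  · rw [← hx, mem_engel_iff]
    exact ⟨1, by simpa using hy⟩
  · rw [neg_lie, lie_skew, ad_apply, add_comm]

/-- All Cartan subalgebras of a semisimple Lie algebra have dimension equal to the rank. -/
lemma finrank_cartan_eq_rank (H : LieSubalgebra ℂ 𝔤) [H.IsCartanSubalgebra] :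
    finrank ℂ H = rank ℂ 𝔤 := by
  obtain ⟨x, hxH, hx⟩ := exists_engel_eq_cartan H
  refine le_antisymm ?_ (by rw [← hx]; exact rank_le_finrank_engel ℂ x)
  let b := finBasis ℂ 𝔤
  let φ : 𝔤 ≃ₗ[ℂ] (Fin (finrank ℂ 𝔤) → ℂ) := b.equivFun
  let A := coordinateBracket φ
  have hAapp : ∀ m y, A m y = φ ⁅φ.symm m, φ.symm y⁆ := coordinateBracket_apply φ
  have hA : ∀ m y, A (A m y) = A m * A y - A y * A m := by
    intro m y
    ext1 v
    simp [hAapp]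
  have hchar : ∀ y, LinearMap.charpoly (A y : (Fin (finrank ℂ 𝔤) → ℂ) →ₗ[ℂ] _) =
      (ad ℂ 𝔤 (φ.symm y)).charpoly := fun y => by
    rw [← LinearEquiv.charpoly_conj φ (ad ℂ 𝔤 (φ.symm y))]
    congr 1
  have hev := eventually_exists_exp_apply_eq A (H.toSubmodule.map φ.toLinearMap)
    ⟨φ x, Submodule.mem_map_of_mem hxH⟩ (fun v => by
      obtain ⟨m, y, hy, hmy⟩ := exists_lie_add_eq hxH hx (φ.symm v)
      refine ⟨φ m, ⟨φ y, Submodule.mem_map_of_mem hy⟩, ?_⟩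
      simp only [hAapp, LinearEquiv.symm_apply_apply]
      rw [← map_add, hmy, LinearEquiv.apply_symm_apply])
  -- Regularity is the nonvanishing of a nonzero polynomial, so it occurs in every neighbourhood:
  -- some regular `z` is conjugate to a `y ∈ H`. Then `y` is regular too, and its Engel subalgebra
  -- contains `H`.
  obtain ⟨z, ⟨m, ⟨_, y, hy, rfl⟩, hz⟩, hne⟩ :=
    exists_eval_ne_zero_of_mem_nhds (polyCharpoly_coeff_rank_ne_zero ℂ 𝔤 b) hev
  have hreg : IsRegular ℂ (φ.symm z) := by
    rw [isRegular_iff_coeff_polyCharpoly_rank_ne_zero ℂ b]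
    have : (b.repr (φ.symm z) : Fin (finrank ℂ 𝔤) → ℂ) = z := φ.apply_symm_apply z
    rwa [this]
  rw [isRegular_iff_finrank_engel_eq_rank, finrank_engel, ← hchar, ← hz,
    charpoly_exp_apply A hA, hchar, ← finrank_engel] at hreg
  rw [← hreg]
  have hy' : φ.symm (φ y) ∈ H := by
    rw [LinearEquiv.symm_apply_apply]
    exact hy
  exact Submodule.finrank_mono (show H.toSubmodule ≤ (engel ℂ (φ.symm (φ y))).toSubmodule from
    cartan_le_engel H hy')

end Cartan

/-! ### Eigenspaces of the involution and their dimensions -/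

section Involution

variable {𝔤 : Type*} [LieRing 𝔤] [LieAlgebra ℂ 𝔤] {σ : 𝔤 ≃ₗ⁅ℂ⁆ 𝔤}

lemma mem_fixedSpace {x : 𝔤} : x ∈ fixedSpace σ ↔ σ x = x := Iff.rfl

lemma mem_negSpace {x : 𝔤} : x ∈ negSpace σ ↔ σ x = -x := Iff.rfl

lemma isCompl_fixedSpace_negSpace (hσ : ∀ x, σ (σ x) = x) :
    IsCompl (fixedSpace σ) (negSpace σ) := by
  constructor
  · rw [Submodule.disjoint_def]
    intro x h1 h2
    rw [mem_fixedSpace] at h1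
    rw [mem_negSpace, h1] at h2
    have h3 : (2 : ℂ) • x = 0 := by
      rw [two_smul, add_eq_zero_iff_eq_neg]
      exact h2
    exact (smul_eq_zero.1 h3).resolve_left two_ne_zero
  · rw [codisjoint_iff, eq_top_iff]
    intro x _
    refine Submodule.mem_sup.2 ⟨(1 / 2 : ℂ) • (x + σ x), ?_, (1 / 2 : ℂ) • (x - σ x), ?_, ?_⟩
    · rw [mem_fixedSpace, map_smul, map_add, hσ, add_comm]
    · rw [mem_negSpace, map_smul, map_sub, hσ, ← smul_neg, neg_sub]
    · module

lemma trilin_eq_zero_of_mem_negSpace {x y z : 𝔤} (hx : x ∈ negSpace σ) (hy : y ∈ negSpace σ)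
    (hz : z ∈ negSpace σ) : trilin x y z = 0 := by
  have h := trilin_map σ x y z
  rw [mem_negSpace.1 hx, mem_negSpace.1 hy, mem_negSpace.1 hz] at h
  refine self_eq_neg.1 (h.symm.trans ?_)
  simp [trilin]

lemma lie_mem_fixedSpace {x y : 𝔤} (hx : x ∈ negSpace σ) (hy : y ∈ negSpace σ) :
    ⁅x, y⁆ ∈ fixedSpace σ := by
  rw [mem_fixedSpace, LieEquiv.map_lie, mem_negSpace.1 hx, mem_negSpace.1 hy, neg_lie, lie_neg,
    neg_neg]

lemma lie_mem_negSpace {x y : 𝔤} (hx : x ∈ fixedSpace σ) (hy : y ∈ negSpace σ) :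
    ⁅x, y⁆ ∈ negSpace σ := by
  rw [mem_negSpace, LieEquiv.map_lie, mem_fixedSpace.1 hx, mem_negSpace.1 hy, lie_neg]

variable [FiniteDimensional ℂ 𝔤] [IsKilling ℂ 𝔤]

lemma orthogonal_fixedSpace (hσ : ∀ x, σ (σ x) = x) :
    (killingForm ℂ 𝔤).orthogonal (fixedSpace σ) = negSpace σ := by
  symm
  refine Submodule.eq_of_le_of_finrank_le ?_ ?_
  · intro y hy x hx
    have h := killingForm_of_equiv_apply (R := ℂ) σ x y
    rw [mem_fixedSpace.1 hx, mem_negSpace.1 hy, map_neg] at h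
    exact self_eq_neg.1 h.symm
  · have h1 := finrank_add_finrank_orthogonal (fixedSpace σ)
    have h2 := Submodule.finrank_add_eq_of_isCompl (isCompl_fixedSpace_negSpace hσ)
    omega

lemma finrank_negSpace_eq (hσ : ∀ x, σ (σ x) = x) (H : LieSubalgebra ℂ 𝔤)
    [H.IsCartanSubalgebra] (hH : H.toSubmodule ≤ negSpace σ) :
    finrank ℂ (negSpace σ) = finrank ℂ (fixedSpace σ) + rank ℂ 𝔤 := by
  obtain ⟨x, hxH, hx⟩ := exists_engel_eq_cartan H
  have hcompl := isCompl_fixedSpace_negSpace hσ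
  let T : negSpace σ →ₗ[ℂ] 𝔤 := (ad ℂ 𝔤 x).domRestrict (negSpace σ)
  have hT : ∀ v : negSpace σ, T v = ⁅x, (v : 𝔤)⁆ := fun _ => rfl
  have hker : LinearMap.ker T = H.toSubmodule.comap (negSpace σ).subtype := by
    ext v
    rw [LinearMap.mem_ker, hT, Submodule.mem_comap, Submodule.subtype_apply,
      LieSubalgebra.mem_toSubmodule]
    refine ⟨fun h => ?_, fun h => lie_eq_zero_of_mem_cartan H hxH h⟩
    rw [← hx, LieSubalgebra.mem_engel_iff]
    exact ⟨1, by simpa using h⟩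
  have hrange : LinearMap.range T = fixedSpace σ := by
    refine le_antisymm ?_ fun f hf => ?_
    · rintro _ ⟨v, rfl⟩
      exact lie_mem_fixedSpace (hH hxH) v.2
    · obtain ⟨m, y, hy, hmy⟩ := exists_lie_add_eq hxH hx f
      obtain ⟨a, ha, b, hb, rfl⟩ := Submodule.mem_sup.1
        (hcompl.sup_eq_top ▸ Submodule.mem_top : m ∈ fixedSpace σ ⊔ negSpace σ)
      -- In `f = [a, x] + [b, x] + y` the terms `[a, x]` and `y` are in the `-1`-eigenspace, the
      -- others are fixed. So `f = [b, x]`.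
      have h1 : f - ⁅b, x⁆ ∈ fixedSpace σ := Submodule.sub_mem _ hf (lie_mem_fixedSpace hb (hH hxH))
      have h2 : f - ⁅b, x⁆ = ⁅a, x⁆ + y := by
        rw [← hmy, add_lie]
        abel
      have h3 : f - ⁅b, x⁆ ∈ negSpace σ := h2 ▸ Submodule.add_mem _
        (lie_mem_negSpace ha (hH hxH)) (hH hy)
      have h4 := Submodule.disjoint_def.1 hcompl.disjoint _ h1 h3
      refine ⟨-⟨b, hb⟩, ?_⟩
      rw [hT, sub_eq_zero.1 h4, Submodule.coe_neg, lie_neg, lie_skew]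
  have h := LinearMap.finrank_range_add_finrank_ker T
  rw [hrange, hker, (Submodule.comapSubtypeEquivOfLe hH).finrank_eq] at h
  rw [← h, ← finrank_cartan_eq_rank H]
  rfl

lemma exists_cartan_le_negSpace [Nontrivial 𝔤] (h : symmetricRank σ = rank ℂ 𝔤) :
    ∃ H : LieSubalgebra ℂ 𝔤, H.IsCartanSubalgebra ∧ H.toSubmodule ≤ negSpace σ := by
  let S := {r | ∃ H : LieSubalgebra ℂ 𝔤, H.IsCartanSubalgebra ∧ (∀ x ∈ H, σ x ∈ H) ∧
    r = finrank ℂ (H.toSubmodule ⊓ negSpace σ : Submodule ℂ 𝔤)}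
  have hS : sSup S = rank ℂ 𝔤 := h
  -- The supremum of the empty set is `0` in `ℕ`, which the positive rank excludes; so the supremum
  -- is attained.
  have hne : S.Nonempty := by
    by_contra hem
    rw [Set.not_nonempty_iff_eq_empty] at hem
    rw [hem, csSup_empty] at hS
    exact (rank_pos (𝔤 := 𝔤)).ne hS
  have hbdd : BddAbove S := ⟨finrank ℂ 𝔤, by
    rintro _ ⟨H, -, -, rfl⟩
    exact Submodule.finrank_le _⟩
  obtain ⟨H, hH, -, hr⟩ := Nat.sSup_mem hne hbdd
  refine ⟨H, hH, inf_eq_left.1 (Submodule.eq_of_le_of_finrank_le inf_le_left ?_)⟩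
  rw [← hr, hS]
  exact (finrank_cartan_eq_rank H).le

end Involution

/-! ### The adjoint group preserves the Killing form and `w` -/

section AdjointGroup

variable {𝔤 : Type*} [LieRing 𝔤] [LieAlgebra ℂ 𝔤]

lemma exists_lieEquiv_of_nilpotent {x : 𝔤} {N : ℕ} (hN : ad ℂ 𝔤 x ^ N = 0) :
    ∃ e : 𝔤 ≃ₗ⁅ℂ⁆ 𝔤, ∀ y,
      e y = (∑ n ∈ Finset.range N, ((n.factorial : ℂ)⁻¹) • ad ℂ 𝔤 x ^ n : End ℂ 𝔤) y := by
  -- `LieDerivation.exp` has rational coefficients, so the scalars are restricted to `ℚ`.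
  let : Module ℚ 𝔤 := Module.compHom 𝔤 (algebraMap ℚ ℂ)
  let : LieAlgebra ℚ 𝔤 :=
    { lie_smul := fun q a b => lie_smul ((q : ℂ)) a b }
  let D : LieDerivation ℂ 𝔤 𝔤 := LieDerivation.ad ℂ 𝔤 x
  have hD : D.toLinearMap = ad ℂ 𝔤 x := by
    ext y
    simp [D]
  have hnil : IsNilpotent D.toLinearMap := ⟨N, by rw [hD, hN]⟩
  refine ⟨LieDerivation.exp D hnil, fun y => ?_⟩
  rw [LieDerivation.exp_map_apply D hnil, hD, IsNilpotent.exp_eq_sum hN]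
  simp only [LinearMap.sum_apply, LinearMap.smul_apply]
  refine Finset.sum_congr rfl fun n _ => ?_
  rw [← Rat.cast_smul_eq_qsmul ℂ]
  simp

lemma exists_lieEquiv_of_mem_adjointGroup {a : 𝔤 ≃ₗ[ℂ] 𝔤} (ha : a ∈ adjointGroup 𝔤) :
    ∃ e : 𝔤 ≃ₗ⁅ℂ⁆ 𝔤, ∀ y, e y = a y := by
  induction ha using Subgroup.closure_induction with
  | mem a ha =>
    obtain ⟨x, N, hN, hx⟩ := ha
    obtain ⟨e, he⟩ := exists_lieEquiv_of_nilpotent hN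
    exact ⟨e, fun y => by rw [he, ← hx]; rfl⟩
  | one => exact ⟨LieEquiv.refl, fun y => rfl⟩
  | mul a b _ _ ha hb =>
    obtain ⟨e, he⟩ := ha
    obtain ⟨e', he'⟩ := hb
    exact ⟨e'.trans e, fun y => by
      rw [LieEquiv.trans_apply, he, he']
      rfl⟩
  | inv a _ ha =>
    obtain ⟨e, he⟩ := ha
    refine ⟨e.symm, fun y => e.injective ?_⟩
    change e (e.symm y) = e (a⁻¹ y)
    rw [LieEquiv.apply_symm_apply, he]
    exact (a.apply_symm_apply y).symm

variable [FiniteDimensional ℂ 𝔤] [IsKilling ℂ 𝔤]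

/-- An automorphism preserves `κ` and `w`, so its inverse takes the orthogonal of the translate back
to the `-1`-eigenspace. -/
lemma trilin_eq_zero_of_mem_symmetricOrbit {σ : 𝔤 ≃ₗ⁅ℂ⁆ 𝔤} (hσ : ∀ x, σ (σ x) = x)
    {W : Gr (finrank ℂ (fixedSpace σ)) 𝔤} (hW : W ∈ symmetricOrbit σ) :
    ∀ x ∈ (killingForm ℂ 𝔤).orthogonal W.1, ∀ y ∈ (killingForm ℂ 𝔤).orthogonal W.1,
      ∀ z ∈ (killingForm ℂ 𝔤).orthogonal W.1, trilin x y z = 0 := by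
  obtain ⟨a, ha, hWa⟩ := hW
  obtain ⟨e, he⟩ := exists_lieEquiv_of_mem_adjointGroup ha
  have key : ∀ x ∈ (killingForm ℂ 𝔤).orthogonal W.1, e.symm x ∈ negSpace σ := by
    intro x hx
    rw [← orthogonal_fixedSpace hσ]
    intro f hf
    have h := killingForm_of_equiv_apply (R := ℂ) e f (e.symm x)
    rw [LieEquiv.apply_symm_apply] at h
    refine h.symm.trans (hx _ ?_)
    rw [hWa, he]
    exact Submodule.mem_map_of_mem hf
  intro x hx y hy z hz
  rw [← trilin_map e.symm]
  exact trilin_eq_zero_of_mem_negSpace (key x hx) (key y hy) (key z hz)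

end AdjointGroup

/-! ### The embedding of the wonderful compactification -/

section Embedding

lemma isZariskiClosed_setOf_submodule_le {V : Type*} [AddCommGroup V] [Module ℂ V]
    (N : Submodule ℂ V) : IsZariskiClosed {x : ℙ ℂ V | x.submodule ≤ N} := by
  refine ⟨MvPolynomial.X '' N.dualAnnihilator, ?_, ?_⟩
  · rintro _ ⟨φ, -, rfl⟩
    exact ⟨1, MvPolynomial.isHomogeneous_X _ _⟩
  · ext x
    simp only [Set.mem_ofPred_eq, Set.forall_mem_image, polyValue, MvPolynomial.eval_X]
    rw [x.submodule_eq, Submodule.span_singleton_le_iff_mem]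
    conv_lhs => rw [← Subspace.dualAnnihilator_dualCoannihilator_eq (W := N)]
    exact Submodule.mem_dualCoannihilator _

lemma exists_map_subtype_eq {V : Type*} [AddCommGroup V] [Module ℂ V] {N : Submodule ℂ V}
    {x : ℙ ℂ V} (hx : x.submodule ≤ N) :
    ∃ y : ℙ ℂ N, Projectivization.map N.subtype N.injective_subtype y = x :=
  ⟨Projectivization.mk ℂ ⟨x.rep, hx (rep_mem_submodule x)⟩
    (fun h => x.rep_nonzero (congrArg Subtype.val h)), by
    rw [Projectivization.map_mk]
    exact x.mk_rep⟩

lemma map_symm_comp_subtype_eq {V V' : Type*} [AddCommGroup V] [Module ℂ V] [AddCommGroup V']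
    [Module ℂ V'] (s : V ≃ₗ[ℂ] V') {N : Submodule ℂ V'} {y : ℙ ℂ N} {x : ℙ ℂ V}
    (h : Projectivization.map N.subtype N.injective_subtype y =
      Projectivization.map s.toLinearMap s.injective x) :
    Projectivization.map (s.symm.toLinearMap ∘ₗ N.subtype)
      (s.symm.injective.comp N.injective_subtype) y = x := by
  induction y using Projectivization.ind with
  | h v hv =>
    induction x using Projectivization.ind with
    | h u hu =>
      simp only [Projectivization.map_mk, Projectivization.mk_eq_mk_iff'] at h ⊢
      obtain ⟨a, ha⟩ := h
      refine ⟨a, s.injective ?_⟩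
      simpa using ha

variable {𝔤 : Type*} [LieRing 𝔤] [LieAlgebra ℂ 𝔤] [FiniteDimensional ℂ 𝔤] [IsKilling ℂ 𝔤]

/-- The star is linear, so the condition on `W` is Zariski closed, and it suffices to check it on
the orbit. -/
lemma map_hodgeStar_submodule_le {σ : 𝔤 ≃ₗ⁅ℂ⁆ 𝔤} (hσ : ∀ x, σ (σ x) = x) {k : ℕ}
    (e : Basis (Fin (finrank ℂ (fixedSpace σ) + (k + 3))) ℂ 𝔤)
    {W : Gr (finrank ℂ (fixedSpace σ)) 𝔤} (hW : W ∈ wonderful σ) :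
    (Projectivization.map (hodgeStar e) (hodgeStar_injective e) (pluckerPoint W)).submodule ≤
      equationSpace k := by
  have hcl := (isZariskiClosed_setOf_submodule_le (equationSpace (𝔤 := 𝔤) k)).preimage_map
    (hodgeStar e) (hodgeStar_injective e)
  refine zariskiClosure_subset hcl ?_ hW
  rintro _ ⟨U, hU, rfl⟩
  have h1 := finrank_add_finrank_orthogonal U.1
  have h2 := finrank_eq_card_basis e
  rw [Fintype.card_fin] at h2
  have h3 := U.2
  have hfin : finrank ℂ ((killingForm ℂ 𝔤).orthogonal U.1) = k + 3 := by omega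
  rw [Set.mem_preimage, map_hodgeStar_pluckerPoint e U ⟨_, hfin⟩ rfl]
  exact pluckerPoint_submodule_le_equationSpace _ (trilin_eq_zero_of_mem_symmetricOrbit hσ hU)

/-- Taking orthogonals embeds the wonderful compactification in `ℙ(N)`. -/
lemma exists_isClosedEmbedding_wonderful [Nontrivial 𝔤] {k : ℕ}
    (hk : k + 3 = (finrank ℂ 𝔤 + rank ℂ 𝔤) / 2) {σ : 𝔤 ≃ₗ⁅ℂ⁆ 𝔤} (hσ : ∀ x, σ (σ x) = x)
    (hr : symmetricRank σ = rank ℂ 𝔤) :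
    ∃ f : wonderful σ → ℙ ℂ (equationSpace (𝔤 := 𝔤) k),
      (∀ W : wonderful σ, ∃ h : finrank ℂ ((killingForm ℂ 𝔤).orthogonal W.1.1) = k + 3,
        Projectivization.map (equationSpace (𝔤 := 𝔤) k).subtype (Submodule.injective_subtype _)
          (f W) = pluckerPoint ⟨(killingForm ℂ 𝔤).orthogonal W.1.1, h⟩) ∧
      IsClosedEmbedding (fun W : wonderful σ => pluckerPoint W.1) f := by
  obtain ⟨H, hH, hHσ⟩ := exists_cartan_le_negSpace hr
  have hdim1 := finrank_negSpace_eq hσ H hHσ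
  have hdim2 := Submodule.finrank_add_eq_of_isCompl (isCompl_fixedSpace_negSpace hσ)
  -- Here `dim 𝔤 + l` is twice the dimension of the `-1`-eigenspace, so the division in `hk` is
  -- exact.
  have hdim : finrank ℂ 𝔤 = finrank ℂ (fixedSpace σ) + (k + 3) := by omega
  let e : Basis (Fin (finrank ℂ (fixedSpace σ) + (k + 3))) ℂ 𝔤 :=
    (finBasis ℂ 𝔤).reindex (finCongr hdim)
  choose f hf using fun W : wonderful σ =>
    exists_map_subtype_eq (map_hodgeStar_submodule_le hσ e W.2)
  have hfin : ∀ W : wonderful σ, finrank ℂ ((killingForm ℂ 𝔤).orthogonal W.1.1) = k + 3 := by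
    intro W
    have h1 := finrank_add_finrank_orthogonal W.1.1
    have h2 := W.1.2
    omega
  refine ⟨f, fun W => ⟨hfin W, (hf W).trans (map_hodgeStar_pluckerPoint e _ _ rfl)⟩, ?_⟩
  let star : ⋀[ℂ]^(finrank ℂ (fixedSpace σ)) 𝔤 ≃ₗ[ℂ] ⋀[ℂ]^(k + 3) 𝔤 :=
    LinearEquiv.ofBijective (hodgeStar e) ⟨hodgeStar_injective e, hodgeStar_surjective e⟩
  refine isClosedEmbedding_of_map_eq (fun W W' h => Subtype.ext (pluckerPoint_injective h)) ?_
    (star.symm.toLinearMap ∘ₗ (equationSpace k).subtype)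
    (star.symm.injective.comp (equationSpace k).injective_subtype) fun W => ?_
  · have hrange : Set.range (fun W : wonderful σ => pluckerPoint W.1) =
        zariskiClosure (pluckerPoint '' symmetricOrbit σ) := by
      rw [zariskiClosure_image_pluckerPoint, Set.image_eq_range]
      rfl
    rw [hrange]
    exact isZariskiClosed_zariskiClosure _
  · exact map_symm_comp_subtype_eq star (hf W)

end Embedding

end WonderfulLinear

end

theorem proposition11 {𝔤 : Type*} [LieRing 𝔤] [LieAlgebra ℂ 𝔤] [FiniteDimensional ℂ 𝔤]
    [LieAlgebra.IsSimple ℂ 𝔤] (k : ℕ)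
    (hk : k + 3 = (Module.finrank ℂ 𝔤 + LieAlgebra.rank ℂ 𝔤) / 2) :
    Function.Injective (WonderfulLinear.toSection (𝔤 := 𝔤) (k + 3)) ∧
    (LinearMap.range (WonderfulLinear.delta (𝔤 := 𝔤) k)).map (WonderfulLinear.toSection (k + 3)) ≤
      WonderfulLinear.sectionsIY (k + 3) ∧
    Module.finrank ℂ (WonderfulLinear.equationSpace (𝔤 := 𝔤) k) <
      Module.finrank ℂ (⋀[ℂ]^(k + 3) 𝔤) ∧
    ∀ σ : 𝔤 ≃ₗ⁅ℂ⁆ 𝔤, (∀ x, σ (σ x) = x) →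
      WonderfulLinear.symmetricRank σ = LieAlgebra.rank ℂ 𝔤 →
      ∃ f : WonderfulLinear.wonderful σ → ℙ ℂ (WonderfulLinear.equationSpace (𝔤 := 𝔤) k),
        (∀ W : WonderfulLinear.wonderful σ,
          ∃ h : Module.finrank ℂ ((killingForm ℂ 𝔤).orthogonal W.1.1) = k + 3,
            Projectivization.map (WonderfulLinear.equationSpace (𝔤 := 𝔤) k).subtype
              (Submodule.injective_subtype _) (f W) =
            WonderfulLinear.pluckerPoint ⟨(killingForm ℂ 𝔤).orthogonal W.1.1, h⟩) ∧
        WonderfulLinear.IsClosedEmbedding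
          (fun W : WonderfulLinear.wonderful σ => WonderfulLinear.pluckerPoint W.1) f := by
  -- With `hk` this gives `3 ≤ k + 3 ≤ dim 𝔤`.
  have hle := rank_le_finrank ℂ 𝔤
  have : Nontrivial 𝔤 := Module.nontrivial_of_finrank_pos (R := ℂ) (by omega)
  exact ⟨WonderfulLinear.toSection_injective _, WonderfulLinear.map_toSection_range_delta_le k,
    WonderfulLinear.finrank_equationSpace_lt (by omega),
    fun σ hσ hr => WonderfulLinear.exists_isClosedEmbedding_wonderful hk hσ hr⟩
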